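/- **Setting.** Consider a rooted tree with root (feeder) $0$ and finitely many further nodes $i=1,\dots,I$; the edge entering $k\neq 0$ from its parent $\pi(k)$ has resistance $R_k>0$ and reactance $X_k\in\mathbb R$. $\mathcal N(k)$ denotes the set of nodes of the subtree rooted at $k$. There are finitely many types $j=1,\dots,J$ of electric vehicles (EVs). Let $M_i>0$ (node capacities), $c_j^{\max}>0$ (maximal charging rates), $\lambda_{ij}>0$ (arrival rates), $K_i\in\{1,2,\dots\}\cup\{\infty\}$ (parking spaces), and let $W_{00}$ (squared feeder voltage) and the voltage limits satisfy $0<\underline\upsilon_k<W_{00}\le\overline\upsilon_k$ for all $k\ne 0$. The charging requirement and parking time $(B_j,D_j)$ of a type-$j$ EV have an arbitrary joint law with $B_j>0$, $D_j>0$ a.s. and $\mathbb E[D_j]<\infty$. The utilities $u_{ij}$ are strictly increasing and concave on $[0,\infty)$ (the value $u_{ij}(0)=-\infty$ is allowed), real valued and twice differentiable on $(0,\infty)$, with $u_{ij}'(x)\to\infty$ as $x\downarrow 0$. For $z\ge 0$, rates $p$ are *feasible* if $\sum_j z_{ij}p_{ij}\le M_i$, $0\le p_{ij}\le c_j^{\max}$,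 and the loads $\Lambda_{ij}=z_{ij}p_{ij}$ satisfy the voltage constraints of one of the following models (the same model throughout). * *AC model*: there are reals $W_{kk}$ ($k\ne0$) and $W_{\pi(k)k}$ such that for all $k\neq0$: $\underline\upsilon_k\le W_{kk}\le\overline\upsilon_k$, the matrix $\begin{pmatrix}W_{\pi(k)\pi(k)}&W_{\pi(k)k}\\W_{\pi(k)k}&W_{kk}\end{pmatrix}$ is positive semidefinite of rank one, and $W_{\pi(k)k}-W_{kk}-P_kR_k-Q_kX_k=0$, where $P_k=\sum_{l\in\mathcal N(k)}\sum_j\Lambda_{lj}+\sum_{s\in\mathcal N(k)\setminus\{k\}}\ell_sR_s$, $Q_k=\sum_{s\in\mathcal N(k)\setminus\{k\}}\ell_sX_s$ and $\ell_s=(W_{\pi(s)\pi(s)}-2W_{\pi(s)s}+W_{ss})/(R_s^2+X_s^2)$. * *Linearized Distflow model*: $\underline\upsilon_k\le W_{00}-2\sum_{s:\,k\in\mathcal N(s)}R_s\sum_{l\in\mathcal N(s)}\sum_j\Lambda_{lj}\le\overline\upsilon_k$ for all $k\ne0$. An *allocation mechanism* is a function $z\mapsto p(z)$ on $\{z\ge0\}$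 such that $p(z)$ maximizes $\sum_{i,j}z_{ij}u_{ij}(p_{ij})$ (with $0\cdot(-\infty)=0$) over the feasible $p$, and $p_{ij}(z)=0$ whenever $z_{ij}=0$. It is *monotone* if $0<y\le z$ (coordinatewise, all $y_{ij}>0$) implies $p_{ij}(y)\ge p_{ij}(z)$ for all $i,j$. A nonnegative continuous function $z(\cdot)$ on $[0,\infty)$ is a *fluid-model solution* for nonnegative initial charging requirements and parking times $(B^0_{ij},D^0_{ij})$ if, for some initial total populations $q_{ij}(0)\ge z_{ij}(0)$ and all $t\ge0$, $$z_{ij}(t)=z_{ij}(0)\,\mathbb P\Big(B^0_{ij}>\int_0^tp_{ij}(z(v))dv,\;D^0_{ij}\ge t\Big)+\int_0^t\gamma_{ij}(s)\,\mathbb P\Big(B_j>\int_s^tp_{ij}(z(v))dv,\;D_j\ge t-s\Big)ds,$$ $$q_{ij}(t)=q_{ij}(0)\,\mathbb P(D^0_{ij}\ge t)+\int_0^t\gamma_{ij}(s)\,\mathbb P(D_j\ge t-s)\,ds,\qquad \gamma_{ij}(t)=\lambda_{ij}\mathbf 1\Big\{\sum_{j'}q_{ij'}(t)<K_i\Big\}.$$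 An *invariant point* is a vector $z^*$ such that $z(t)\equiv z^*$ is a fluid-model solution for some initial laws. **Proposition 2.** Suppose that the allocation mechanism is monotone, that $K_i=\infty$ for all $i$, and that, for every $j$, the leftmost point of the support of $D_j/B_j$ is at most $1/c_j^{\max}$. Then the fluid model has a unique invariant point $z^*$, this $z^*$ is also the unique nonnegative solution of $$z^*_{ij}=\lambda_{ij}\,\mathbb E\Big[\min\Big\{D_j,\frac{B_j}{p_{ij}(z^*)}\Big\}\Big]\qquad(B_j/0:=\infty),$$ and every fluid-model solution, for any initial data, satisfies $z_{ij}(t)\to z^*_{ij}$ as $t\to\infty$ for all $i,j$. -/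

import Mathlib

open MeasureTheory Filter Topology Set
open scoped ENNReal

noncomputable section

namespace EVCharging

/-- A utility function on `[0, ∞)`. It is real valued on `(0, ∞)`; the value at `0` may be `-∞`
(as for `log`), hence the codomain `EReal`. Concavity up to `0` follows from monotonicity and
concavity on `(0, ∞)`. -/
structure IsUtility (u : ℝ → EReal) : Prop where
  finite : ∀ x, 0 < x → u x ≠ ⊥ ∧ u x ≠ ⊤
  strictMono : StrictMonoOn u (Ici 0)
  concave : ConcaveOn ℝ (Ioi 0) (fun x => (u x).toReal)
  differentiable : DifferentiableOn ℝ (fun x => (u x).toReal) (Ioi 0)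
  differentiable_deriv : DifferentiableOn ℝ (deriv (fun x => (u x).toReal)) (Ioi 0)
  deriv_zero : Tendsto (deriv (fun x => (u x).toReal)) (𝓝[>] 0) atTop

/-- The data of the charging network. `ι` is the set of nodes other than the feeder and `J` the set
of vehicle types. In `Option ι`, `none` is the feeder and `some i` the node `i`. The edge that
enters node `k` (from `parent k`) is indexed by `k`. -/
structure Network (ι J : Type*) [Fintype ι] [Fintype J] where
  /-- the parent in the rooted tree -/
  parent : ι → Option ι
  /-- there are no cycles: every node is below the feeder -/
  acyclic : WellFounded (fun a b : ι => parent b = some a)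
  /-- resistance of the edge entering `k` -/
  R : ι → ℝ
  R_pos : ∀ k, 0 < R k
  /-- reactance of the edge entering `k` -/
  X : ι → ℝ
  /-- squared voltage magnitude at the feeder -/
  W₀ : ℝ
  /-- lower and upper limits for the squared voltage magnitudes -/
  vLow : ι → ℝ
  vHigh : ι → ℝ
  vLow_pos : ∀ k, 0 < vLow k
  vLow_lt : ∀ k, vLow k < W₀
  le_vHigh : ∀ k, W₀ ≤ vHigh k
  /-- power capacity of node `i` -/
  M : ι → ℝ
  M_pos : ∀ i, 0 < M i
  /-- maximal charging rate of type `j` -/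
  cmax : J → ℝ
  cmax_pos : ∀ j, 0 < cmax j
  /-- number of parking spaces, possibly infinite -/
  K : ι → ℕ∞
  K_pos : ∀ i, 0 < K i
  /-- arrival rates -/
  lam : ι → J → ℝ
  lam_pos : ∀ i j, 0 < lam i j
  /-- joint law of (charging requirement, parking time) = `(B j, D j)` for type `j` -/
  F : J → Measure (ℝ × ℝ)
  F_prob : ∀ j, IsProbabilityMeasure (F j)
  F_pos : ∀ j, ∀ᵐ x ∂(F j), 0 < x.1 ∧ 0 < x.2
  /-- parking times have finite mean -/
  F_mean : ∀ j, Integrable (fun x : ℝ × ℝ => x.2) (F j)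
  /-- utility functions -/
  u : ι → J → ℝ → EReal
  u_utility : ∀ i j, IsUtility (u i j)

/-- The two load flow models. -/
inductive FlowModel
  | ac
  | linDistflow

namespace Network

variable {ι J : Type*} [Fintype ι] [Fintype J] (N : Network ι J)

/-- `N.Below k l`: node `l` belongs to the subtree rooted at `k` (including `k` itself). -/
def Below (k l : ι) : Prop := Relation.ReflTransGen (fun a b : ι => N.parent b = some a) k l

open Classical in
/-- Nodes of the subtree rooted at `k`. -/
def subtree (k : ι) : Finset ι := Finset.univ.filter (fun l => N.Below k l)

open Classical in
/-- Edges of the subtree rooted at `k`, each indexed by its lower endpoint. -/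
def subtreeEdges (k : ι) : Finset ι := (N.subtree k).erase k

open Classical in
/-- Edges of the path from the feeder to `k`, each indexed by its lower endpoint. -/
def path (k : ι) : Finset ι := Finset.univ.filter (fun s => N.Below s k)

/-- The matrix `W(ε)` of the edge entering `k`, from the diagonal entries `w` (indexed by nodes)
and the off-diagonal entries `o` (indexed by edges). -/
def edgeMatrix (w : Option ι → ℝ) (o : ι → ℝ) (k : ι) : Matrix (Fin 2) (Fin 2) ℝ :=
  !![w (N.parent k), o k; o k, w (some k)]

/-- Active power loss along the edge entering `s`. -/
def lossP (w : Option ι → ℝ) (o : ι → ℝ) (s : ι) : ℝ :=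
  (w (N.parent s) - 2 * o s + w (some s)) * N.R s / (N.R s ^ 2 + N.X s ^ 2)

/-- Reactive power loss along the edge entering `s`. -/
def lossQ (w : Option ι → ℝ) (o : ι → ℝ) (s : ι) : ℝ :=
  (w (N.parent s) - 2 * o s + w (some s)) * N.X s / (N.R s ^ 2 + N.X s ^ 2)

/-- Active power consumed by the subtree rooted at `k`, when type-`j` vehicles at node `l` consume
`L l j` in total. -/
def powerP (L : ι → J → ℝ) (w : Option ι → ℝ) (o : ι → ℝ) (k : ι) : ℝ :=
  ∑ l ∈ N.subtree k, ∑ j, L l j + ∑ s ∈ N.subtreeEdges k, N.lossP w o s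

/-- Reactive power consumed by the subtree rooted at `k`. -/
def powerQ (w : Option ι → ℝ) (o : ι → ℝ) (k : ι) : ℝ :=
  ∑ s ∈ N.subtreeEdges k, N.lossQ w o s

/-- The loads `L` satisfy the voltage constraints of the AC model: there are voltages `W` solving
the power flow equations, within the limits, with positive semidefinite rank-one edge matrices. -/
def ACFeasible (L : ι → J → ℝ) : Prop :=
  ∃ (w : Option ι → ℝ) (o : ι → ℝ), w none = N.W₀ ∧
    (∀ k, N.vLow k ≤ w (some k) ∧ w (some k) ≤ N.vHigh k) ∧
    (∀ k, o k - w (some k) - N.powerP L w o k * N.R k - N.powerQ w o k * N.X k = 0) ∧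
    (∀ k, (N.edgeMatrix w o k).PosSemidef ∧ (N.edgeMatrix w o k).rank = 1)

/-- Squared voltage magnitude at node `k` in the linearized Distflow model. -/
def Wlin (L : ι → J → ℝ) (k : ι) : ℝ :=
  N.W₀ - 2 * ∑ s ∈ N.path k, N.R s * ∑ m ∈ N.subtree s, ∑ j, L m j

/-- The loads `L` satisfy the voltage constraints of the given load flow model. -/
def VoltageFeasible (m : FlowModel) (L : ι → J → ℝ) : Prop :=
  match m with
  | .ac => N.ACFeasible L
  | .linDistflow => ∀ k, N.vLow k ≤ N.Wlin L k ∧ N.Wlin L k ≤ N.vHigh k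

/-- `p` is a feasible vector of charging rates in state `z`: load and voltage constraints. -/
def Feasible (m : FlowModel) (z p : ι → J → ℝ) : Prop :=
  (∀ i, ∑ j, z i j * p i j ≤ N.M i) ∧ (∀ i j, 0 ≤ p i j ∧ p i j ≤ N.cmax j) ∧
    N.VoltageFeasible m (fun i j => z i j * p i j)

/-- The total utility of the rates `p` in state `z` (in `EReal`, `0 * (-∞) = 0`). -/
def objective (z p : ι → J → ℝ) : EReal :=
  ∑ i, ∑ j, ((z i j : ℝ) : EReal) * N.u i j (p i j)

/-- `p` is an allocation mechanism: `p z` maximizes the total utility under the constraints, with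
the convention that `p z i j = 0` when `z i j = 0`. -/
def IsAllocation (m : FlowModel) (p : (ι → J → ℝ) → ι → J → ℝ) : Prop :=
  ∀ z : ι → J → ℝ, (∀ i j, 0 ≤ z i j) →
    N.Feasible m z (p z) ∧ (∀ q, N.Feasible m z q → N.objective z q ≤ N.objective z (p z)) ∧
    ∀ i j, z i j = 0 → p z i j = 0

/-- Modified arrival rate in the fluid model, given the total fluid `q` at the nodes. -/
def gammaT (q : ℝ → ι → J → ℝ) (i : ι) (j : J) (t : ℝ) : ℝ :=
  open Classical in
  if ENNReal.ofReal (∑ j', q t i j') < (N.K i : ℝ≥0∞) then N.lam i j else 0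

/-- `z` is a fluid-model solution, where `F₀ i j` is the joint law of the charging requirement and
the parking time of the type-`j` vehicles that are initially at node `i`. -/
def IsFluidSolution (p : (ι → J → ℝ) → ι → J → ℝ) (F₀ : ι → J → Measure (ℝ × ℝ))
    (z : ℝ → ι → J → ℝ) : Prop :=
  (∀ i j, IsProbabilityMeasure (F₀ i j) ∧ ∀ᵐ x ∂(F₀ i j), 0 ≤ x.1 ∧ 0 ≤ x.2) ∧
  (∀ t, 0 ≤ t → ∀ i j, 0 ≤ z t i j) ∧
  ContinuousOn z (Ici 0) ∧
  (∀ t, 0 ≤ t → ∀ i j, IntervalIntegrable (fun v => p (z v) i j) volume 0 t) ∧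
  ∃ q : ℝ → ι → J → ℝ,
    (∀ i j, z 0 i j ≤ q 0 i j) ∧
    (∀ t, 0 ≤ t → ∀ i j, IntervalIntegrable (N.gammaT q i j) volume 0 t) ∧
    (∀ t, 0 ≤ t → ∀ i j, q t i j =
      q 0 i j * (F₀ i j).real {x | t ≤ x.2} +
        ∫ s in (0 : ℝ)..t, N.gammaT q i j s * (N.F j).real {x | t - s ≤ x.2}) ∧
    (∀ t, 0 ≤ t → ∀ i j, z t i j =
      z 0 i j * (F₀ i j).real {x | (∫ v in (0 : ℝ)..t, p (z v) i j) < x.1 ∧ t ≤ x.2} +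
        ∫ s in (0 : ℝ)..t, N.gammaT q i j s *
          (N.F j).real {x | (∫ v in s..t, p (z v) i j) < x.1 ∧ t - s ≤ x.2})

/-- `y` is an invariant point of the fluid model: for a suitable initial population the constant
function `y` is a fluid-model solution. -/
def IsInvariantPoint (p : (ι → J → ℝ) → ι → J → ℝ) (y : ι → J → ℝ) : Prop :=
  ∃ F₀ : ι → J → Measure (ℝ × ℝ), N.IsFluidSolution p F₀ (fun _ => y)

/-- The equilibrium arrival rate `γ i j`. -/
def gammaInf (i : ι) (j : J) : ℝ≥0∞ :=
  ENNReal.ofReal (N.lam i j) / ENNReal.ofReal (∑ j', N.lam i j') *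
    min (ENNReal.ofReal (∑ j', N.lam i j'))
      ((N.K i : ℝ≥0∞) * (∑ j', ENNReal.ofReal (N.lam i j') / ENNReal.ofReal (∑ k, N.lam i k) *
        ∫⁻ x, ENNReal.ofReal x.2 ∂(N.F j'))⁻¹)

/-- The fixed-point equation `y = γ E[min(D, B / p(y))]`, where `B / 0 = ∞`. -/
def IsFixedPoint (p : (ι → J → ℝ) → ι → J → ℝ) (y : ι → J → ℝ) : Prop :=
  ∀ i j, 0 ≤ y i j ∧ ENNReal.ofReal (y i j) = N.gammaInf i j *
    ∫⁻ x, min (ENNReal.ofReal x.2) (ENNReal.ofReal x.1 / ENNReal.ofReal (p y i j)) ∂(N.F j)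

/-- The leftmost point of the support of the law of `D j / B j`. -/
def infRatio (j : J) : ℝ := sInf ((N.F j).map (fun x : ℝ × ℝ => x.2 / x.1)).support

end Network

/-- Monotone allocation mechanism. -/
def IsMonotone {ι J : Type*} (p : (ι → J → ℝ) → ι → J → ℝ) : Prop :=
  ∀ y z : ι → J → ℝ, (∀ i j, 0 < y i j) → (∀ i j, y i j ≤ z i j) → ∀ i j, p z i j ≤ p y i j

end EVCharging

end

/-! Write `m_j(r) = E[min(D_j, B_j/r)]`. Since `K = ∞`, the equilibrium equation reads `y = λ
m(p(y))`. Both `m` and a monotone `p` reverse the order, so the right-hand side preserves it on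
positive states. Iterating from the extreme rates `cmax` and `0` gives an increasing sequence
`lower` and a decreasing sequence `upper`.

The heart is that their limits `x ≤ w` coincide (`exists_common_limit`). Let `a ≥ b` be the limits
of the rates along the two sequences. The limiting loads are `x a = λ a m(a)` and `w b = λ b m(b)`,
and `r m(r) = E[min(rD, B)]` is strictly increasing on `[0, cmax]` by the support hypothesis
(`mul_meanSojourn_lt`). Hence the smaller state carries at least the load of the larger one. But
feasibility of the voltages depends on the loads only, so the larger state could carry those loads
too; if they were strictly bigger somewhere, total utility would improve, against optimality
(`IsAllocation.limit_load_eq`). So the loads agree, `a = b` and `x = w`.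

Everything else is squeezed between the iterates. A rate that is eventually at most `c` forces `z`
to be asymptotically at least `λ m(c)`, and dually, so every fluid solution eventually lies between
`lower n` and `upper n` (`IsFluidSolution.eventually_mem`); fixed points do too
(`bounds_of_fixedPoint`). An initial population in stationary regime turns the fixed point into an
invariant point.

Utilities may be `-∞` at `0`, so optimal utilities must be shown finite. This needs positive
feasible rates, which in the AC model are built by prescribing voltages (`exists_pos_acFeasible`).
-/

namespace EVCharging

/-! ### Mean sojourn time and mean energy received at a constant rate -/

/-- For `b, d > 0` and `r ≥ 0` this is `min d (b / r)`, with `b / 0 = ∞`. -/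
noncomputable def sojourn (r : ℝ) (x : ℝ × ℝ) : ℝ := x.2 * x.1 / max x.1 (r * x.2)

lemma sojourn_pos {r : ℝ} {x : ℝ × ℝ} (h : 0 < x.1 ∧ 0 < x.2) : 0 < sojourn r x :=
  div_pos (mul_pos h.2 h.1) (lt_max_of_lt_left h.1)

lemma sojourn_le {r : ℝ} {x : ℝ × ℝ} (h : 0 < x.1 ∧ 0 < x.2) : sojourn r x ≤ x.2 := by
  unfold sojourn
  rw [div_le_iff₀ (lt_max_of_lt_left h.1)]
  exact mul_le_mul_of_nonneg_left (le_max_left _ _) h.2.le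

lemma sojourn_anti {r s : ℝ} (hrs : r ≤ s) {x : ℝ × ℝ} (h : 0 < x.1 ∧ 0 < x.2) :
    sojourn s x ≤ sojourn r x := by
  unfold sojourn
  have h1 := h.1
  have h2 := h.2
  gcongr

/-- This is the energy received. It increases with the rate although the sojourn time decreases; the
uniqueness argument rests on this contrast. -/
lemma mul_sojourn (r : ℝ) {x : ℝ × ℝ} (h : 0 < x.1 ∧ 0 < x.2) :
    r * sojourn r x = min (r * x.2) x.1 := by
  unfold sojourn
  have : 0 < max x.1 (r * x.2) := lt_max_of_lt_left h.1
  rw [← mul_div_assoc, div_eq_iff this.ne', max_comm, min_mul_max]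
  ring

lemma sojourn_of_pos {r : ℝ} (hr : 0 < r) {x : ℝ × ℝ} (h : 0 < x.1 ∧ 0 < x.2) :
    sojourn r x = min x.2 (x.1 / r) := by
  have := mul_sojourn r h
  have h2 : r * min x.2 (x.1 / r) = min (r * x.2) x.1 := by
    rw [mul_min_of_nonneg _ _ hr.le, mul_div_cancel₀ _ hr.ne']
  exact mul_left_cancel₀ hr.ne' (this.trans h2.symm)

lemma sojourn_zero {x : ℝ × ℝ} (h : 0 < x.1 ∧ 0 < x.2) : sojourn 0 x = x.2 := by
  simp [sojourn, max_eq_left h.1.le, h.1.ne']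

lemma measurable_sojourn (r : ℝ) : Measurable (sojourn r) := by
  unfold sojourn
  fun_prop

lemma ofReal_sojourn {r : ℝ} (hr : 0 ≤ r) {x : ℝ × ℝ} (h : 0 < x.1 ∧ 0 < x.2) :
    min (ENNReal.ofReal x.2) (ENNReal.ofReal x.1 / ENNReal.ofReal r) =
      ENNReal.ofReal (sojourn r x) := by
  rcases hr.eq_or_lt with rfl | hr
  · rw [sojourn_zero h, ENNReal.ofReal_zero, ENNReal.div_zero (by simpa using h.1), min_top_right]
  · rw [sojourn_of_pos hr h, ENNReal.ofReal_min, ENNReal.ofReal_div_of_pos hr]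

namespace Network

variable {ι J : Type*} [Fintype ι] [Fintype J] (N : Network ι J)

instance (j : J) : IsProbabilityMeasure (N.F j) := N.F_prob j

/-- The mean time `E[min(D, B / r)]` spent in the system by a vehicle charged at rate `r`. -/
noncomputable def meanSojourn (j : J) (r : ℝ) : ℝ := ∫ x, sojourn r x ∂(N.F j)

lemma integrable_sojourn (j : J) (r : ℝ) : Integrable (sojourn r) (N.F j) := by
  refine (N.F_mean j).mono' (measurable_sojourn r).aestronglyMeasurable ?_
  filter_upwards [N.F_pos j] with x hx
  rw [Real.norm_of_nonneg (sojourn_pos hx).le]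
  exact sojourn_le hx

lemma meanSojourn_anti (j : J) : Antitone (N.meanSojourn j) := by
  intro r s hrs
  refine integral_mono_ae (N.integrable_sojourn j s) (N.integrable_sojourn j r) ?_
  filter_upwards [N.F_pos j] with x hx
  exact sojourn_anti hrs hx

lemma meanSojourn_pos (j : J) (r : ℝ) : 0 < N.meanSojourn j r := by
  unfold meanSojourn
  rw [integral_pos_iff_support_of_nonneg_ae _ (N.integrable_sojourn j r)]
  · have : ∀ᵐ x ∂(N.F j), x ∈ Function.support (sojourn r) := by
      filter_upwards [N.F_pos j] with x hx
      exact (sojourn_pos hx).ne'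
    refine lt_of_lt_of_eq ?_ (measure_congr (eventuallyEq_univ.2 this)).symm
    simp
  · filter_upwards [N.F_pos j] with x hx
    exact (sojourn_pos hx).le

/-- The quotient defining `sojourn` has no singularity at `r = 0`, so dominated convergence with
bound `D` applies there as well. -/
lemma continuous_meanSojourn (j : J) : Continuous (N.meanSojourn j) := by
  refine continuous_of_dominated (fun r => (measurable_sojourn r).aestronglyMeasurable)
    (bound := fun x => x.2) (fun r => ?_) (N.F_mean j) ?_
  · filter_upwards [N.F_pos j] with x hx
    rw [Real.norm_of_nonneg (sojourn_pos hx).le]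
    exact sojourn_le hx
  · filter_upwards [N.F_pos j] with x hx
    unfold sojourn
    refine Continuous.div (by fun_prop) (by fun_prop) fun r => ?_
    exact (lt_max_of_lt_left hx.1).ne'

/-- For `0 < r < cmax` the leftmost support point of `D/B` lies strictly left of `1/r`, so `D/B <
1/r` has positive mass. On this event a slightly higher rate delivers strictly more energy. -/
lemma measure_lt_pos {j : J} {r : ℝ} (hr : 0 ≤ r) (hrc : r < N.cmax j)
    (hinf : N.infRatio j ≤ 1 / N.cmax j) : 0 < N.F j {x | r * x.2 < x.1} := by
  rcases hr.eq_or_lt with rfl | hr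
  · have : ∀ᵐ x ∂(N.F j), x ∈ {x : ℝ × ℝ | 0 * x.2 < x.1} := by
      filter_upwards [N.F_pos j] with x hx
      simpa using hx.1
    refine lt_of_lt_of_eq ?_ (measure_congr (eventuallyEq_univ.2 this)).symm
    simp
  · have hm : Measurable (fun x : ℝ × ℝ => x.2 / x.1) := by fun_prop
    set ν := (N.F j).map (fun x : ℝ × ℝ => x.2 / x.1) with hν
    have : IsProbabilityMeasure ν := Measure.isProbabilityMeasure_map hm.aemeasurable
    have hne : ν.support.Nonempty := Measure.nonempty_support (IsProbabilityMeasure.ne_zero ν)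
    have hlt : sInf ν.support < 1 / r :=
      lt_of_le_of_lt hinf (one_div_lt_one_div_of_lt hr hrc)
    obtain ⟨a, ha, har⟩ := exists_lt_of_csInf_lt hne hlt
    have hpos : 0 < ν (Iio (1 / r)) := by
      rw [Measure.mem_support_iff_forall] at ha
      exact ha _ (Iio_mem_nhds har)
    rw [hν, Measure.map_apply hm measurableSet_Iio] at hpos
    refine hpos.trans_le (measure_mono_ae ?_)
    filter_upwards [N.F_pos j] with x hx h
    have h' : x.2 / x.1 < 1 / r := h
    rw [div_lt_div_iff₀ hx.1 hr] at h'
    change r * x.2 < x.1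
    linarith

/-- The mean amount of energy received is strictly increasing in the charging rate. -/
lemma mul_meanSojourn_lt {j : J} {r s : ℝ} (hr : 0 ≤ r) (hrs : r < s) (hs : s ≤ N.cmax j)
    (hinf : N.infRatio j ≤ 1 / N.cmax j) : r * N.meanSojourn j r < s * N.meanSojourn j s := by
  unfold meanSojourn
  rw [← integral_const_mul, ← integral_const_mul, ← sub_pos,
    ← integral_sub ((N.integrable_sojourn j s).const_mul s)
      ((N.integrable_sojourn j r).const_mul r)]
  rw [integral_pos_iff_support_of_nonneg_ae]
  · refine (N.measure_lt_pos hr (hrs.trans_le hs) hinf).trans_le (measure_mono_ae ?_)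
    filter_upwards [N.F_pos j] with x hx h
    have h' : r * x.2 < x.1 := h
    have h'' : r * x.2 < s * x.2 := mul_lt_mul_of_pos_right hrs hx.2
    change s * sojourn s x - r * sojourn r x ≠ 0
    rw [mul_sojourn s hx, mul_sojourn r hx, min_eq_left h'.le]
    exact (sub_pos.2 (lt_min h'' h')).ne'
  · filter_upwards [N.F_pos j] with x hx
    change 0 ≤ s * sojourn s x - r * sojourn r x
    rw [mul_sojourn s hx, mul_sojourn r hx, sub_nonneg]
    exact min_le_min_right _ (mul_le_mul_of_nonneg_right hrs.le hx.2.le)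
  · exact ((N.integrable_sojourn j s).const_mul s).sub ((N.integrable_sojourn j r).const_mul r)

lemma mul_meanSojourn_mono {j : J} {r s : ℝ} (hr : 0 ≤ r) (hrs : r ≤ s) (hs : s ≤ N.cmax j)
    (hinf : N.infRatio j ≤ 1 / N.cmax j) : r * N.meanSojourn j r ≤ s * N.meanSojourn j s := by
  rcases hrs.eq_or_lt with rfl | h
  · exact le_rfl
  · exact (N.mul_meanSojourn_lt hr h hs hinf).le

/-! ### Survival function at a constant rate -/

/-- The probability that a vehicle charged at rate `c` is still in the system, uncharged, at
age `v`. -/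
noncomputable def survival (j : J) (c v : ℝ) : ℝ := (N.F j).real {x | c * v < x.1 ∧ v ≤ x.2}

lemma survival_nonneg (j : J) (c v : ℝ) : 0 ≤ N.survival j c v := measureReal_nonneg

lemma survival_antitone (j : J) {c : ℝ} (hc : 0 ≤ c) : Antitone (N.survival j c) := by
  intro v w hvw
  refine measureReal_mono fun x hx => ⟨?_, hvw.trans hx.2⟩
  exact (mul_le_mul_of_nonneg_left hvw hc).trans_lt hx.1

/-- The ages at which the vehicle is present form an interval from `0` to its sojourn time; whether
the endpoint belongs to it does not matter for the length. -/
lemma volume_survival {c : ℝ} (hc : 0 ≤ c) {x : ℝ × ℝ} (h : 0 < x.1 ∧ 0 < x.2) :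
    (volume.restrict (Ioi (0 : ℝ))) {v | c * v < x.1 ∧ v ≤ x.2} =
      ENNReal.ofReal (sojourn c x) := by
  have hmeas : MeasurableSet {v : ℝ | c * v < x.1 ∧ v ≤ x.2} :=
    (measurableSet_lt (f := fun v => c * v) (g := fun _ => x.1) (by fun_prop) (by fun_prop)).inter
      (measurableSet_le (f := fun v => v) (g := fun _ => x.2) (by fun_prop) (by fun_prop))
  rw [Measure.restrict_apply hmeas]
  refine le_antisymm ?_ ?_
  · have hsub : {v : ℝ | c * v < x.1 ∧ v ≤ x.2} ∩ Ioi 0 ⊆ Ioc 0 (sojourn c x) := by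
      rintro v ⟨⟨h1, h2⟩, h0⟩
      refine ⟨h0, ?_⟩
      unfold sojourn
      rw [le_div_iff₀ (lt_max_of_lt_left h.1), mul_max_of_nonneg _ _ (le_of_lt h0)]
      refine max_le (mul_le_mul_of_nonneg_right h2 h.1.le) ?_
      nlinarith [h.2]
    simpa using measure_mono (μ := volume) hsub
  · have hsub : Ioo 0 (sojourn c x) ⊆ {v : ℝ | c * v < x.1 ∧ v ≤ x.2} ∩ Ioi 0 := by
      rintro v ⟨h0, h1⟩
      refine ⟨⟨?_, (h1.trans_le (sojourn_le h)).le⟩, h0⟩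
      rcases hc.eq_or_lt with rfl | hc
      · simpa using h.1
      · calc c * v < c * sojourn c x := mul_lt_mul_of_pos_left h1 hc
          _ ≤ x.1 := by rw [mul_sojourn c h]; exact min_le_right _ _
    simpa using measure_mono (μ := volume) hsub

/-- Tonelli on the set of pairs (age, vehicle): integrating over ages first gives the sojourn time
of each vehicle. -/
lemma lintegral_survival (j : J) {c : ℝ} (hc : 0 ≤ c) :
    ∫⁻ v in Ioi (0 : ℝ), ENNReal.ofReal (N.survival j c v) =
      ENNReal.ofReal (N.meanSojourn j c) := by
  have hS : MeasurableSet {y : ℝ × (ℝ × ℝ) | c * y.1 < y.2.1 ∧ y.1 ≤ y.2.2} :=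
    (measurableSet_lt (f := fun y : ℝ × (ℝ × ℝ) => c * y.1) (g := fun y => y.2.1)
      (by fun_prop) (by fun_prop)).inter
      (measurableSet_le (f := fun y : ℝ × (ℝ × ℝ) => y.1) (g := fun y => y.2.2)
        (by fun_prop) (by fun_prop))
  have h1 := Measure.prod_apply (μ := volume.restrict (Ioi (0 : ℝ))) (ν := N.F j) hS
  have h2 := Measure.prod_apply_symm (μ := volume.restrict (Ioi (0 : ℝ))) (ν := N.F j) hS
  unfold meanSojourn
  rw [ofReal_integral_eq_lintegral_ofReal (N.integrable_sojourn j c)]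
  · calc ∫⁻ v in Ioi (0 : ℝ), ENNReal.ofReal (N.survival j c v)
        = ∫⁻ v in Ioi (0 : ℝ),
            N.F j (Prod.mk v ⁻¹' {y : ℝ × (ℝ × ℝ) | c * y.1 < y.2.1 ∧ y.1 ≤ y.2.2}) := by
          refine lintegral_congr fun v => ?_
          rw [survival, ofReal_measureReal]
          rfl
      _ = _ := h1.symm.trans h2
      _ = ∫⁻ x, ENNReal.ofReal (sojourn c x) ∂(N.F j) := by
          refine lintegral_congr_ae ?_
          filter_upwards [N.F_pos j] with x hx
          exact volume_survival hc hx
  · filter_upwards [N.F_pos j] with x hx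
    exact (sojourn_pos hx).le

lemma integrableOn_survival (j : J) {c : ℝ} (hc : 0 ≤ c) :
    IntegrableOn (N.survival j c) (Ioi 0) := by
  refine ⟨(N.survival_antitone j hc).measurable.aestronglyMeasurable, ?_⟩
  rw [hasFiniteIntegral_iff_ofReal (Eventually.of_forall fun v => N.survival_nonneg j c v),
    N.lintegral_survival j hc]
  exact ENNReal.ofReal_lt_top

lemma integral_survival (j : J) {c : ℝ} (hc : 0 ≤ c) :
    ∫ v in Ioi (0 : ℝ), N.survival j c v = N.meanSojourn j c := by
  rw [integral_eq_lintegral_of_nonneg_ae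
    (Eventually.of_forall fun v => N.survival_nonneg j c v)
    (N.survival_antitone j hc).measurable.aestronglyMeasurable, N.lintegral_survival j hc,
    ENNReal.toReal_ofReal (N.meanSojourn_pos j c).le]

lemma tendsto_integral_survival (j : J) {c : ℝ} (hc : 0 ≤ c) :
    Tendsto (fun t => ∫ v in (0 : ℝ)..t, N.survival j c v) atTop (𝓝 (N.meanSojourn j c)) := by
  rw [← N.integral_survival j hc]
  exact intervalIntegral_tendsto_integral_Ioi 0 (N.integrableOn_survival j hc) tendsto_id

lemma gammaT_of_top {q : ℝ → ι → J → ℝ} {i : ι} (hK : N.K i = ⊤) (j : J) (t : ℝ) :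
    N.gammaT q i j t = N.lam i j := by
  simp [gammaT, hK]

lemma gammaInf_of_top {i : ι} (hK : N.K i = ⊤) (j : J) :
    N.gammaInf i j = ENNReal.ofReal (N.lam i j) := by
  have hsum : 0 < ∑ j', N.lam i j' :=
    Finset.sum_pos (fun j' _ => N.lam_pos i j') ⟨j, Finset.mem_univ j⟩
  have hfin : (∑ j', ENNReal.ofReal (N.lam i j') / ENNReal.ofReal (∑ k, N.lam i k) *
      ∫⁻ x, ENNReal.ofReal x.2 ∂(N.F j')) ≠ ⊤ := by
    refine (ENNReal.sum_lt_top.2 fun j' _ => ENNReal.mul_lt_top ?_ ?_).ne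
    · exact ENNReal.div_lt_top ENNReal.ofReal_ne_top (by simpa using hsum)
    · exact (N.F_mean j').lintegral_lt_top
  unfold gammaInf
  -- Finiteness of `E[D]` is essential: it keeps the inverse nonzero, whereas `⊤ * 0 = 0` in `ℝ≥0∞`.
  rw [hK, ENat.toENNReal_top, ENNReal.top_mul (ENNReal.inv_ne_zero.2 hfin), min_top_right]
  exact ENNReal.div_mul_cancel (by simpa using hsum) ENNReal.ofReal_ne_top

end Network

/-! ### Trees, and positive feasible loads in both flow models -/

namespace Network

variable {ι J : Type*} [Fintype ι] [Fintype J] (N : Network ι J)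

/-- Cumulative sums along the paths from the feeder. -/
lemma exists_potential {A : Type*} [AddMonoid A] (c : ι → A) :
    ∃ h : Option ι → A, h none = 0 ∧ ∀ k, h (some k) = h (N.parent k) + c k := by
  classical
  let step : ∀ k : ι, (∀ a : ι, N.parent k = some a → A) → A := fun k rec =>
    (match hk : N.parent k with
      | none => 0
      | some a => rec a hk) + c k
  let f : ι → A := N.acyclic.fix step
  refine ⟨fun o => o.elim 0 f, rfl, fun k => ?_⟩
  change f k = _
  have hf : f k = step k (fun a _ => f a) := N.acyclic.fix_eq step k
  rw [hf]
  change (match hk : N.parent k with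
      | none => 0
      | some a => f a) + c k = _
  congr 1
  split <;> rename_i h <;> simp [h]

lemma mem_subtreeEdges_iff {k c : ι} :
    c ∈ N.subtreeEdges k ↔ ∃ l ∈ N.subtree k, N.parent c = some l := by
  -- With unit increments the potential is the depth, which prevents a node from lying below its own
  -- child.
  obtain ⟨d, -, hd⟩ := N.exists_potential (fun _ => (1 : ℕ))
  have hmono : ∀ {a b}, N.Below a b → d (some a) ≤ d (some b) := by
    intro a b hab
    induction hab with
    | refl => exact le_rfl
    | @tail _ e _ h ih => exact ih.trans (by rw [hd e, h]; exact Nat.le_succ _)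
  simp only [subtreeEdges, subtree, Finset.mem_erase, Finset.mem_filter, Finset.mem_univ, true_and]
  constructor
  · rintro ⟨hne, hb⟩
    rcases Relation.ReflTransGen.cases_tail hb with h | ⟨l, hl, hlc⟩
    · exact absurd h hne
    · exact ⟨l, hl, hlc⟩
  · rintro ⟨l, hl, hlc⟩
    refine ⟨?_, hl.tail hlc⟩
    rintro rfl
    have h1 := hmono hl
    have h2 := hd c
    rw [hlc] at h2
    omega

open Classical in
lemma sum_subtree_children (f : ι → ℝ) (k : ι) :
    ∑ l ∈ N.subtree k, ∑ c with N.parent c = some l, f c = ∑ c ∈ N.subtreeEdges k, f c := by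
  rw [← Finset.sum_biUnion]
  · refine Finset.sum_congr ?_ fun _ _ => rfl
    ext c
    simp [N.mem_subtreeEdges_iff]
  · intro a _ b _ hab
    rw [Function.onFun, Finset.disjoint_left]
    intro c hc hc'
    simp only [Finset.mem_filter, Finset.mem_univ, true_and] at hc hc'
    rw [hc] at hc'
    exact hab (Option.some.inj hc')

lemma self_mem_subtree (k : ι) : k ∈ N.subtree k := by
  simp only [subtree, Finset.mem_filter, Finset.mem_univ, true_and]
  exact Relation.ReflTransGen.refl

-- Conservation of power, telescoped. If `A l` enters the subtree of `l` and each child `c` draws `A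
-- c + ℓ c` from `l`, then the loads left at the nodes plus the internal losses add up to `A k`.
open Classical in
lemma sum_subtree_sub_children (A : ι → ℝ) (ℓ : ι → ℝ) (k : ι) :
    ∑ l ∈ N.subtree k, (A l - ∑ c with N.parent c = some l, (A c + ℓ c)) +
      ∑ s ∈ N.subtreeEdges k, ℓ s = A k := by
  rw [Finset.sum_sub_distrib, sum_subtree_children, Finset.sum_add_distrib, subtreeEdges,
    ← Finset.sum_erase_add _ _ (N.self_mem_subtree k)]
  ring

lemma edge_posSemidef_rank {a b : ℝ} (ha : 0 < a) :
    (!![a ^ 2, a * b; a * b, b ^ 2] : Matrix (Fin 2) (Fin 2) ℝ).PosSemidef ∧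
      (!![a ^ 2, a * b; a * b, b ^ 2] : Matrix (Fin 2) (Fin 2) ℝ).rank = 1 := by
  have h : (!![a ^ 2, a * b; a * b, b ^ 2] : Matrix (Fin 2) (Fin 2) ℝ) =
      Matrix.vecMulVec ![a, b] (star ![a, b]) := by
    ext i j
    fin_cases i <;> fin_cases j <;> simp [Matrix.vecMulVec_apply] <;> ring
  rw [h]
  refine ⟨Matrix.posSemidef_vecMulVec_self_star _, le_antisymm (Matrix.rank_vecMulVec_le _ _) ?_⟩
  rw [Nat.one_le_iff_ne_zero, ← h, Matrix.rank]
  intro h0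
  rw [Submodule.finrank_eq_zero, LinearMap.range_eq_bot] at h0
  have := congrFun (LinearMap.congr_fun h0 ![1, 0]) 0
  simp [ha.ne'] at this

open Classical in
/-- There are weights on the nodes that exceed the sum of the weights of the children. -/
lemma exists_weight : ∃ n : ι → ℝ, (∀ k, 0 < n k) ∧
    ∀ l, ∑ c with N.parent c = some l, n c < n l := by
  obtain ⟨d, -, hd⟩ := N.exists_potential (fun _ => (1 : ℕ))
  -- The weights are `ρ ^ depth`; a node has at most `|ι|` children and `|ι| ρ < 1`.
  set ρ : ℝ := 1 / (Fintype.card ι + 1) with hρ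
  have hρ0 : 0 < ρ := by positivity
  refine ⟨fun k => ρ ^ d (some k), fun k => by positivity, fun l => ?_⟩
  calc ∑ c with N.parent c = some l, ρ ^ d (some c)
      = ∑ c with N.parent c = some l, ρ ^ d (some l) * ρ := by
        refine Finset.sum_congr rfl fun c hc => ?_
        simp only [Finset.mem_filter, Finset.mem_univ, true_and] at hc
        rw [hd c, hc, pow_succ]
    _ ≤ Fintype.card ι * (ρ ^ d (some l) * ρ) := by
        rw [Finset.sum_const, nsmul_eq_mul]
        gcongr
        exact Finset.card_le_univ _
    _ = ρ ^ d (some l) * (Fintype.card ι / (Fintype.card ι + 1)) := by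
        rw [hρ]; ring
    _ < ρ ^ d (some l) * 1 := by
        gcongr
        rw [div_lt_one (by positivity)]
        linarith
    _ = _ := mul_one _

open Classical in
/-- The AC power flow equations are solved by prescribing the voltages: a small voltage drop along
each edge, first order in `ε`, leads to losses of second order, hence to positive loads. -/
lemma exists_pos_acFeasible [Nonempty J] {η : ℝ} (hη : 0 < η) :
    ∃ L : ι → J → ℝ, (∀ i j, 0 < L i j ∧ L i j ≤ η) ∧ N.ACFeasible L := by
  rcases isEmpty_or_nonempty ι with hι | ⟨⟨k₀⟩⟩
  · exact ⟨fun i => isEmptyElim i, fun i => isEmptyElim i, fun _ => N.W₀, fun i => isEmptyElim i,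
      rfl, fun i => isEmptyElim i, fun i => isEmptyElim i, fun i => isEmptyElim i⟩
  have hW : 0 < N.W₀ := (N.vLow_pos k₀).trans (N.vLow_lt k₀)
  set V₀ := √N.W₀ with hV₀
  have hV₀pos : 0 < V₀ := Real.sqrt_pos.2 hW
  have hV₀sq : V₀ ^ 2 = N.W₀ := Real.sq_sqrt hW.le
  obtain ⟨n, hn, hnl⟩ := N.exists_weight
  obtain ⟨h, h0, hh⟩ := N.exists_potential (fun k => N.R k * n k)
  -- Voltage magnitudes, whose squares are the diagonal of `W`; the drop along edge `k` is `ε R_k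
  -- n_k`. The losses are then `ε ^ 2 * ℓP` and `ε ^ 2 * ℓQ`.
  let V : ℝ → Option ι → ℝ := fun ε o => V₀ - ε * h o
  let ℓP : ι → ℝ := fun s => (N.R s * n s) ^ 2 * N.R s / (N.R s ^ 2 + N.X s ^ 2)
  let ℓQ : ι → ℝ := fun s => (N.R s * n s) ^ 2 * N.X s / (N.R s ^ 2 + N.X s ^ 2)
  let E : ι → ℝ := fun k => n k * h (some k) + (∑ s ∈ N.subtreeEdges k, ℓQ s) * N.X k / N.R k
  -- The power flow equation at `k`, solved for the active power `P_k`. Below, `S ε l` is the load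
  -- that this leaves at node `l`.
  let A : ℝ → ι → ℝ := fun ε k => ε * (n k * V₀) - ε ^ 2 * E k
  let S : ℝ → ι → ℝ := fun ε l =>
    A ε l - ∑ c with N.parent c = some l, (A ε c + ε ^ 2 * ℓP c)
  -- The coefficient of `ε` is `V₀` times the excess of the weight of `l` over those of its
  -- children, hence positive; so the loads are positive for small `ε`.
  have hS : ∀ ε l, S ε l = ε * (V₀ * (n l - ∑ c with N.parent c = some l, n c) -
      ε * (E l - ∑ c with N.parent c = some l, (E c - ℓP c))) := by
    intro ε l
    simp only [S, A]
    rw [show ∑ c with N.parent c = some l, (ε * (n c * V₀) - ε ^ 2 * E c + ε ^ 2 * ℓP c) =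
      ε * V₀ * (∑ c with N.parent c = some l, n c) -
        ε ^ 2 * ∑ c with N.parent c = some l, (E c - ℓP c) by
      rw [Finset.mul_sum, Finset.mul_sum, ← Finset.sum_sub_distrib]
      exact Finset.sum_congr rfl fun c _ => by ring]
    ring
  have hpos : ∀ᶠ ε in 𝓝[>] (0 : ℝ), ∀ l, 0 < S ε l := by
    rw [eventually_all]
    intro l
    have hc : Tendsto (fun ε : ℝ => V₀ * (n l - ∑ c with N.parent c = some l, n c) -
      ε * (E l - ∑ c with N.parent c = some l, (E c - ℓP c))) (𝓝[>] 0)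
      (𝓝 (V₀ * (n l - ∑ c with N.parent c = some l, n c))) := by
      refine tendsto_nhdsWithin_of_tendsto_nhds ?_
      refine Continuous.tendsto' (by fun_prop) _ _ (by ring)
    have := hc.eventually_const_lt (mul_pos hV₀pos (sub_pos.2 (hnl l)))
    filter_upwards [this, self_mem_nhdsWithin] with ε hε hε0
    rw [hS]
    exact mul_pos hε0 hε
  have hsmall : ∀ᶠ ε in 𝓝[>] (0 : ℝ), ∀ l, S ε l < η := by
    rw [eventually_all]
    intro l
    have hc : Tendsto (fun ε => S ε l) (𝓝[>] 0) (𝓝 0) := by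
      refine tendsto_nhdsWithin_of_tendsto_nhds ?_
      simp only [hS]
      exact Continuous.tendsto' (by fun_prop) _ _ (by ring)
    exact hc.eventually_lt_const hη
  have hVpos : ∀ᶠ ε in 𝓝[>] (0 : ℝ), ∀ o, 0 < V ε o := by
    rw [eventually_all]
    intro o
    have hc : Tendsto (fun ε => V ε o) (𝓝[>] 0) (𝓝 V₀) := by
      refine tendsto_nhdsWithin_of_tendsto_nhds ?_
      exact Continuous.tendsto' (by fun_prop) _ _ (by simp [V])
    exact hc.eventually_const_lt hV₀pos
  have hVlow : ∀ᶠ ε in 𝓝[>] (0 : ℝ), ∀ k, N.vLow k < V ε (some k) ^ 2 := by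
    rw [eventually_all]
    intro k
    have hc : Tendsto (fun ε => V ε (some k) ^ 2) (𝓝[>] 0) (𝓝 N.W₀) := by
      refine tendsto_nhdsWithin_of_tendsto_nhds ?_
      exact Continuous.tendsto' (by fun_prop) _ _ (by simp [V, hV₀sq])
    exact hc.eventually_const_lt (N.vLow_lt k)
  have hhnonneg : ∀ k, 0 ≤ h (some k) := by
    intro k
    induction k using N.acyclic.induction with
    | _ k ih =>
      have h1 : 0 ≤ h (N.parent k) := by
        cases hk : N.parent k with
        | none => exact h0.ge
        | some a => exact ih a hk
      rw [hh]
      have := mul_pos (N.R_pos k) (hn k)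
      linarith
  obtain ⟨ε, hεpos, hεsmall, hεV, hεlow, hε0⟩ :=
    (hpos.and (hsmall.and (hVpos.and (hVlow.and self_mem_nhdsWithin)))).exists
  have hε0' : 0 < ε := hε0
  have hcard : 0 < (Fintype.card J : ℝ) := by exact_mod_cast Fintype.card_pos
  have hcard1 : 1 ≤ (Fintype.card J : ℝ) := by exact_mod_cast Fintype.card_pos
  let w : Option ι → ℝ := fun o => V ε o ^ 2
  let o : ι → ℝ := fun k => V ε (N.parent k) * V ε (some k)
  have hdrop : ∀ k, V ε (N.parent k) - V ε (some k) = ε * (N.R k * n k) := by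
    intro k
    simp only [V]
    rw [hh k]
    ring
  have hℓ : ∀ k, w (N.parent k) - 2 * o k + w (some k) = ε ^ 2 * (N.R k * n k) ^ 2 := by
    intro k
    rw [← mul_pow, ← hdrop]
    simp only [w, o]
    ring
  have hPl : ∀ k, N.lossP w o k = ε ^ 2 * ℓP k := by
    intro k
    simp only [lossP, hℓ, ℓP]
    ring
  have hQl : ∀ k, N.lossQ w o k = ε ^ 2 * ℓQ k := by
    intro k
    simp only [lossQ, hℓ, ℓQ]
    ring
  -- The load of a node is shared equally among the vehicle types.
  refine ⟨fun l _ => S ε l / Fintype.card J, fun i j => ⟨div_pos (hεpos i) hcard, ?_⟩,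
    w, o, ?_, fun k => ⟨(hεlow k).le, ?_⟩, fun k => ?_, fun k => ?_⟩
  · exact (div_le_self (hεpos i).le hcard1).trans (hεsmall i).le
  · simp only [w, V, h0, mul_zero, sub_zero, hV₀sq]
  · refine le_trans ?_ (N.le_vHigh k)
    rw [← hV₀sq]
    refine pow_le_pow_left₀ (hεV _).le ?_ 2
    exact sub_le_self _ (mul_nonneg hε0'.le (hhnonneg k))
  · have hP : N.powerP (fun l (_ : J) => S ε l / Fintype.card J) w o k = A ε k := by
      rw [← N.sum_subtree_sub_children (A ε) (fun c => ε ^ 2 * ℓP c) k]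
      simp only [powerP, hPl]
      congr 1
      refine Finset.sum_congr rfl fun l _ => ?_
      rw [Finset.sum_const, nsmul_eq_mul, Finset.card_univ, mul_div_cancel₀ _ hcard.ne']
    have hQ : N.powerQ w o k = ε ^ 2 * ∑ s ∈ N.subtreeEdges k, ℓQ s := by
      simp only [powerQ, hQl, Finset.mul_sum]
    have how : o k - w (some k) = V ε (some k) * (ε * (N.R k * n k)) := by
      rw [← hdrop]
      simp only [w, o]
      ring
    have hR := (N.R_pos k).ne'
    rw [hP, hQ, how]
    simp only [A, E, V]
    field_simp
    ring
  · exact edge_posSemidef_rank (hεV _)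

/-- A small constant load suffices: `Wlin` is continuous in it with value `W₀ > vLow` at zero, and
nonnegative loads never raise it above `W₀`. -/
lemma exists_pos_linFeasible {η : ℝ} (hη : 0 < η) :
    ∃ L : ι → J → ℝ, (∀ i j, 0 < L i j ∧ L i j ≤ η) ∧
      ∀ k, N.vLow k ≤ N.Wlin L k ∧ N.Wlin L k ≤ N.vHigh k := by
  have hlow : ∀ᶠ ε in 𝓝[>] (0 : ℝ), ∀ k, N.vLow k < N.Wlin (fun _ (_ : J) => ε) k := by
    rw [eventually_all]
    intro k
    have hc : Tendsto (fun ε : ℝ => N.Wlin (fun _ (_ : J) => ε) k) (𝓝[>] 0) (𝓝 N.W₀) := by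
      refine tendsto_nhdsWithin_of_tendsto_nhds ?_
      unfold Wlin
      exact Continuous.tendsto' (by fun_prop) _ _ (by simp)
    exact hc.eventually_const_lt (N.vLow_lt k)
  have hsmall : ∀ᶠ ε in 𝓝[>] (0 : ℝ), ε < η :=
    tendsto_nhdsWithin_of_tendsto_nhds tendsto_id |>.eventually_lt_const hη
  obtain ⟨ε, hεlow, hεη, hε0⟩ := (hlow.and (hsmall.and self_mem_nhdsWithin)).exists
  have hε0' : 0 < ε := hε0
  refine ⟨fun _ _ => ε, fun _ _ => ⟨hε0', hεη.le⟩, fun k => ⟨(hεlow k).le, ?_⟩⟩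
  refine le_trans (sub_le_self _ ?_) (N.le_vHigh k)
  refine mul_nonneg zero_le_two (Finset.sum_nonneg fun s _ => mul_nonneg (N.R_pos s).le ?_)
  exact Finset.sum_nonneg fun _ _ => Finset.sum_nonneg fun _ _ => hε0'.le

lemma exists_pos_voltageFeasible [Nonempty J] (m : FlowModel) {η : ℝ} (hη : 0 < η) :
    ∃ L : ι → J → ℝ, (∀ i j, 0 < L i j ∧ L i j ≤ η) ∧ N.VoltageFeasible m L := by
  cases m with
  | ac => exact N.exists_pos_acFeasible hη
  | linDistflow => exact N.exists_pos_linFeasible hη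

/-- In a positive state there are feasible positive rates. -/
lemma exists_pos_feasible [Nonempty J] (m : FlowModel) {z : ι → J → ℝ} (hz : ∀ i j, 0 < z i j) :
    ∃ q, (∀ i j, 0 < q i j) ∧ N.Feasible m z q := by
  have hcard : 0 < (Fintype.card J : ℝ) := by exact_mod_cast Fintype.card_pos
  have h1 : ∀ᶠ η in 𝓝[>] (0 : ℝ), ∀ i, η < N.M i / Fintype.card J := by
    rw [eventually_all]
    exact fun i => (tendsto_nhdsWithin_of_tendsto_nhds tendsto_id).eventually_lt_const
      (div_pos (N.M_pos i) hcard)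
  have h2 : ∀ᶠ η in 𝓝[>] (0 : ℝ), ∀ i j, η < z i j * N.cmax j := by
    simp only [eventually_all]
    exact fun i j => (tendsto_nhdsWithin_of_tendsto_nhds tendsto_id).eventually_lt_const
      (mul_pos (hz i j) (N.cmax_pos j))
  obtain ⟨η, hM, hc, hη⟩ := (h1.and (h2.and self_mem_nhdsWithin)).exists
  obtain ⟨L, hL, hLf⟩ := N.exists_pos_voltageFeasible m hη
  have hLz : (fun i j => z i j * (L i j / z i j)) = L := by
    funext i j
    rw [mul_div_cancel₀ _ (hz i j).ne']
  refine ⟨fun i j => L i j / z i j, fun i j => div_pos (hL i j).1 (hz i j), fun i => ?_,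
    fun i j => ⟨(div_pos (hL i j).1 (hz i j)).le, ?_⟩, ?_⟩
  · calc ∑ j, z i j * (L i j / z i j) = ∑ j, L i j :=
        Finset.sum_congr rfl fun j _ => congrFun (congrFun hLz i) j
      _ ≤ ∑ _j : J, η := Finset.sum_le_sum fun j _ => (hL i j).2
      _ = Fintype.card J * η := by simp
      _ ≤ N.M i := by
        have := (lt_div_iff₀ hcard).1 (hM i)
        linarith
  · rw [div_le_iff₀ (hz i j), mul_comm]
    exact (hL i j).2.trans (hc i j).le
  · rw [hLz]
    exact hLf

end Network

/-! ### Utilities and consequences of optimality -/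

lemma IsUtility.ne_top {u : ℝ → EReal} (hu : IsUtility u) {x : ℝ} (hx : 0 ≤ x) : u x ≠ ⊤ :=
  ((hu.strictMono (mem_Ici.2 hx) (mem_Ici.2 (by linarith : 0 ≤ x + 1)) (by linarith)).trans_le
    le_top).ne

lemma IsUtility.mono {u : ℝ → EReal} (hu : IsUtility u) {x y : ℝ} (hx : 0 ≤ x) (hxy : x ≤ y) :
    u x ≤ u y :=
  hu.strictMono.monotoneOn (mem_Ici.2 hx) (mem_Ici.2 (hx.trans hxy)) hxy

lemma IsUtility.toReal_lt {u : ℝ → EReal} (hu : IsUtility u) {x y : ℝ} (hx : 0 ≤ x) (hxy : x < y)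
    (hbot : u x ≠ ⊥) : (u x).toReal < (u y).toReal := by
  rw [← EReal.coe_lt_coe_iff, EReal.coe_toReal (hu.ne_top hx) hbot,
    EReal.coe_toReal (hu.ne_top (hx.trans hxy.le)) (hu.finite y (hx.trans_lt hxy)).1]
  exact hu.strictMono (mem_Ici.2 hx) (mem_Ici.2 (hx.trans hxy.le)) hxy

lemma IsUtility.continuousAt {u : ℝ → EReal} (hu : IsUtility u) {x : ℝ} (hx : 0 < x) :
    ContinuousAt (fun x => (u x).toReal) x :=
  (hu.differentiable.differentiableAt (Ioi_mem_nhds hx)).continuousAt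

lemma ereal_sum_ne_bot {α : Type*} {s : Finset α} {f : α → EReal} (h : ∑ a ∈ s, f a ≠ ⊥) :
    ∀ a ∈ s, f a ≠ ⊥ := by
  classical
  intro a ha hfa
  rw [← Finset.add_sum_erase s f ha, hfa, EReal.bot_add] at h
  exact h rfl

lemma ereal_coe_sum {α : Type*} (s : Finset α) (f : α → ℝ) :
    ((∑ a ∈ s, f a : ℝ) : EReal) = ∑ a ∈ s, (f a : EReal) := by
  classical
  induction s using Finset.induction_on with
  | empty => simp
  | insert a s ha ih => rw [Finset.sum_insert ha, Finset.sum_insert ha, EReal.coe_add, ih]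

namespace Network

variable {ι J : Type*} [Fintype ι] [Fintype J] (N : Network ι J)

lemma objective_mono {z q q' : ι → J → ℝ} (hz : ∀ i j, 0 ≤ z i j) (hq : ∀ i j, 0 ≤ q i j)
    (hqq' : ∀ i j, q i j ≤ q' i j) : N.objective z q ≤ N.objective z q' := by
  refine Finset.sum_le_sum fun i _ => Finset.sum_le_sum fun j _ => ?_
  exact mul_le_mul_of_nonneg_left ((N.u_utility i j).mono (hq i j) (hqq' i j))
    (EReal.coe_nonneg.2 (hz i j))

lemma objective_eq_coe {z q : ι → J → ℝ} (hbot : ∀ i j, N.u i j (q i j) ≠ ⊥)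
    (hq : ∀ i j, 0 ≤ q i j) :
    N.objective z q = ((∑ i, ∑ j, z i j * (N.u i j (q i j)).toReal : ℝ) : EReal) := by
  rw [objective, ereal_coe_sum]
  refine Finset.sum_congr rfl fun i _ => ?_
  rw [ereal_coe_sum]
  refine Finset.sum_congr rfl fun j _ => ?_
  rw [EReal.coe_mul, EReal.coe_toReal ((N.u_utility i j).ne_top (hq i j)) (hbot i j)]

variable {N} {m : FlowModel} {p : (ι → J → ℝ) → ι → J → ℝ}

lemma IsAllocation.nonneg (hp : N.IsAllocation m p) {z : ι → J → ℝ} (hz : ∀ i j, 0 ≤ z i j)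
    (i : ι) (j : J) : 0 ≤ p z i j := ((hp z hz).1.2.1 i j).1

lemma IsAllocation.le_cmax (hp : N.IsAllocation m p) {z : ι → J → ℝ} (hz : ∀ i j, 0 ≤ z i j)
    (i : ι) (j : J) : p z i j ≤ N.cmax j := ((hp z hz).1.2.1 i j).2

/-- Positive feasible rates have a finite objective, so the optimum is not `⊥`; but one term equal
to `⊥` makes a whole `EReal` sum `⊥`. -/
lemma IsAllocation.utility_ne_bot (hp : N.IsAllocation m p) {z : ι → J → ℝ}
    (hz : ∀ i j, 0 < z i j) (i : ι) (j : J) : N.u i j (p z i j) ≠ ⊥ := by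
  have : Nonempty J := ⟨j⟩
  obtain ⟨q, hq, hqf⟩ := N.exists_pos_feasible m hz
  have h1 := (hp z fun i j => (hz i j).le).2.1 q hqf
  rw [N.objective_eq_coe (fun i j => ((N.u_utility i j).finite _ (hq i j)).1)
    (fun i j => (hq i j).le)] at h1
  have h2 : N.objective z (p z) ≠ ⊥ := ((EReal.bot_lt_coe _).trans_le h1).ne'
  have h3 := ereal_sum_ne_bot (ereal_sum_ne_bot h2 i (Finset.mem_univ i)) j (Finset.mem_univ j)
  intro h
  rw [h, EReal.coe_mul_bot_of_pos (hz i j)] at h3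
  exact h3 rfl

/-- The loads of a smaller state are feasible in a larger one. -/
lemma IsAllocation.feasible_of_le (hp : N.IsAllocation m p) {y w : ι → J → ℝ}
    (hy : ∀ i j, 0 < y i j) (hyw : ∀ i j, y i j ≤ w i j) :
    N.Feasible m w (fun i j => y i j * p y i j / w i j) := by
  have hy0 : ∀ i j, 0 ≤ y i j := fun i j => (hy i j).le
  have hw : ∀ i j, 0 < w i j := fun i j => (hy i j).trans_le (hyw i j)
  have h : (fun i j => w i j * (y i j * p y i j / w i j)) = fun i j => y i j * p y i j := by
    funext i j
    rw [mul_div_cancel₀ _ (hw i j).ne']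
  obtain ⟨h1, h2, h3⟩ := (hp y hy0).1
  refine ⟨fun i => ?_, fun i j => ⟨?_, ?_⟩, ?_⟩
  · refine le_trans (le_of_eq ?_) (h1 i)
    exact Finset.sum_congr rfl fun j _ => congrFun (congrFun h i) j
  · exact div_nonneg (mul_nonneg (hy0 i j) (h2 i j).1) (hw i j).le
  · rw [div_le_iff₀ (hw i j), mul_comm]
    exact mul_le_mul (h2 i j).2 (hyw i j) (hy0 i j) (N.cmax_pos j).le
  · rw [h]
    exact h3

/-- If the limiting loads of the smaller states dominate those of the larger states, then they
agree: otherwise they would yield a better allocation in the larger states. -/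
lemma IsAllocation.limit_load_eq (hp : N.IsAllocation m p) {y w : ℕ → ι → J → ℝ}
    {y' w' a b : ι → J → ℝ} (hy : ∀ n i j, 0 < y n i j) (hyw : ∀ n i j, y n i j ≤ w n i j)
    (hylim : ∀ i j, Tendsto (fun n => y n i j) atTop (𝓝 (y' i j)))
    (hwlim : ∀ i j, Tendsto (fun n => w n i j) atTop (𝓝 (w' i j)))
    (hw' : ∀ i j, 0 < w' i j)
    (ha : ∀ i j, Tendsto (fun n => p (y n) i j) atTop (𝓝 (a i j)))
    (hb : ∀ n i j, p (w n) i j ≤ b i j)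
    (hab : ∀ i j, w' i j * b i j ≤ y' i j * a i j) (i : ι) (j : J) :
    y' i j * a i j = w' i j * b i j := by
  classical
  have hw : ∀ n i j, 0 < w n i j := fun n i j => (hy n i j).trans_le (hyw n i j)
  have hw0 : ∀ n i j, 0 ≤ w n i j := fun n i j => (hw n i j).le
  have hy0 : ∀ n i j, 0 ≤ y n i j := fun n i j => (hy n i j).le
  have hb0 : ∀ i j, 0 ≤ b i j := fun i j => (hp.nonneg (hw0 0) i j).trans (hb 0 i j)
  have hub : ∀ i j, N.u i j (b i j) ≠ ⊥ := fun i j h => hp.utility_ne_bot (hw 0) i j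
    (le_bot_iff.1 (h ▸ (N.u_utility i j).mono (hp.nonneg (hw0 0) i j) (hb 0 i j)))
  -- `Q n` are the rates that transport the loads of `y n` to the state `w n`, and `q` is their
  -- limit.
  set Q : ℕ → ι → J → ℝ := fun n i j => y n i j * p (y n) i j / w n i j with hQ
  set q : ι → J → ℝ := fun i j => y' i j * a i j / w' i j with hq
  have hQ0 : ∀ n i j, 0 ≤ Q n i j := fun n i j =>
    div_nonneg (mul_nonneg (hy0 n i j) (hp.nonneg (hy0 n) i j)) (hw0 n i j)
  have hQlim : ∀ i j, Tendsto (fun n => Q n i j) atTop (𝓝 (q i j)) := fun i j =>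
    ((hylim i j).mul (ha i j)).div (hwlim i j) (hw' i j).ne'
  have hbq : ∀ i j, b i j ≤ q i j := by
    intro i j
    rw [hq, le_div_iff₀ (hw' i j), mul_comm]
    exact hab i j
  have hq0 : ∀ i j, 0 ≤ q i j := fun i j => (hb0 i j).trans (hbq i j)
  have huq : ∀ i j, N.u i j (q i j) ≠ ⊥ := fun i j h => hub i j
    (le_bot_iff.1 (h ▸ (N.u_utility i j).mono (hb0 i j) (hbq i j)))
  -- Utilities need not be continuous at `0`. Where the limit `q` vanishes, the rate is replaced by
  -- `0`, which only lowers the objective and makes the sequence of utilities constant. The value `u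
  -- 0` is finite there, since `q ≥ b` and `u b` is finite.
  set r : ℕ → ι → J → ℝ := fun n i j => if q i j = 0 then 0 else Q n i j with hr
  have hr0 : ∀ n i j, 0 ≤ r n i j := by
    intro n i j
    simp only [hr]
    split_ifs
    · exact le_rfl
    · exact hQ0 n i j
  have hrQ : ∀ n i j, r n i j ≤ Q n i j := by
    intro n i j
    simp only [hr]
    split_ifs
    · exact hQ0 n i j
    · exact le_rfl
  have hrbot : ∀ᶠ n in atTop, ∀ i j, N.u i j (r n i j) ≠ ⊥ := by
    simp only [eventually_all]
    intro i j
    by_cases h : q i j = 0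
    · refine Eventually.of_forall fun n => ?_
      simp only [hr, if_pos h]
      exact h ▸ huq i j
    · filter_upwards [(hQlim i j).eventually_const_lt ((hq0 i j).lt_of_ne' h)] with n hn
      simp only [hr, if_neg h]
      exact ((N.u_utility i j).finite _ hn).1
  have hrlim : ∀ i j, Tendsto (fun n => (N.u i j (r n i j)).toReal) atTop
      (𝓝 (N.u i j (q i j)).toReal) := by
    intro i j
    by_cases h : q i j = 0
    · simp only [hr, if_pos h]
      rw [h]
      exact tendsto_const_nhds
    · simp only [hr, if_neg h]
      exact ((N.u_utility i j).continuousAt ((hq0 i j).lt_of_ne' h)).tendsto.comp (hQlim i j)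
  -- Optimality is used at each stage `n` and only the resulting inequality passes to the limit, so
  -- no continuity of `p` is required.
  have hle : ∀ᶠ n in atTop, ∑ i, ∑ j, w n i j * (N.u i j (r n i j)).toReal ≤
      ∑ i, ∑ j, w n i j * (N.u i j (b i j)).toReal := by
    filter_upwards [hrbot] with n hn
    rw [← EReal.coe_le_coe_iff, ← N.objective_eq_coe hn (hr0 n), ← N.objective_eq_coe hub hb0]
    calc N.objective (w n) (r n) ≤ N.objective (w n) (Q n) :=
          N.objective_mono (hw0 n) (hr0 n) (hrQ n)
      _ ≤ N.objective (w n) (p (w n)) :=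
          (hp (w n) (hw0 n)).2.1 _ (hp.feasible_of_le (hy n) (hyw n))
      _ ≤ N.objective (w n) b := N.objective_mono (hw0 n) (hp.nonneg (hw0 n)) (hb n)
  have hlim : ∑ i, ∑ j, w' i j * (N.u i j (q i j)).toReal ≤
      ∑ i, ∑ j, w' i j * (N.u i j (b i j)).toReal := by
    refine le_of_tendsto_of_tendsto ?_ ?_ hle
    · exact tendsto_finsetSum _ fun i _ => tendsto_finsetSum _ fun j _ =>
        (hwlim i j).mul (hrlim i j)
    · exact tendsto_finsetSum _ fun i _ => tendsto_finsetSum _ fun j _ =>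
        (hwlim i j).mul tendsto_const_nhds
  by_contra hne
  -- Unequal loads at one coordinate mean `b < q` there, while `b ≤ q` everywhere: the limiting
  -- utility of `q` is strictly larger, against `hlim`.
  have hlt : b i j < q i j := by
    refine lt_of_le_of_ne (hbq i j) fun h => hne ?_
    rw [h, hq, mul_div_cancel₀ _ (hw' i j).ne']
  have hterm : ∀ i j, w' i j * (N.u i j (b i j)).toReal ≤ w' i j * (N.u i j (q i j)).toReal := by
    intro i j
    refine mul_le_mul_of_nonneg_left ?_ (hw' i j).le
    exact EReal.toReal_le_toReal ((N.u_utility i j).mono (hb0 i j) (hbq i j)) (hub i j)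
      ((N.u_utility i j).ne_top (hq0 i j))
  refine absurd hlim (not_le.2 ?_)
  refine Finset.sum_lt_sum (fun i _ => Finset.sum_le_sum fun j _ => hterm i j)
    ⟨i, Finset.mem_univ i, Finset.sum_lt_sum (fun j _ => hterm i j) ⟨j, Finset.mem_univ j, ?_⟩⟩
  exact mul_lt_mul_of_pos_left ((N.u_utility i j).toReal_lt (hb0 i j) hlt (hub i j)) (hw' i j)

end Network

/-! ### Monotone iteration and its common limit -/

namespace Network

variable {ι J : Type*} [Fintype ι] [Fintype J] (N : Network ι J)

/-- Iterates of the fixed-point map `y ↦ λ E[min(D, B / p(y))]`, the `n`-th one multiplied by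
`θ n`; the first one uses the rates `c`. -/
noncomputable def iterates (p : (ι → J → ℝ) → ι → J → ℝ) (θ : ℕ → ℝ) (c : J → ℝ) :
    ℕ → ι → J → ℝ
  | 0 => fun i j => θ 0 * (N.lam i j * N.meanSojourn j (c j))
  | n + 1 => fun i j => θ (n + 1) * (N.lam i j * N.meanSojourn j (p (iterates p θ c n) i j))

/-- Iterates from below. The factors leave room for approximate inequalities. -/
noncomputable def lower (p : (ι → J → ℝ) → ι → J → ℝ) : ℕ → ι → J → ℝ :=
  N.iterates p (fun n => 1 - 1 / ((n : ℝ) + 2)) N.cmax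

/-- Iterates from above. -/
noncomputable def upper (p : (ι → J → ℝ) → ι → J → ℝ) : ℕ → ι → J → ℝ :=
  N.iterates p (fun n => 1 + 1 / ((n : ℝ) + 2)) 0

lemma lowerFactor_pos (n : ℕ) : 0 < 1 - 1 / ((n : ℝ) + 2) := by
  rw [sub_pos, div_lt_one (by positivity)]
  linarith [(Nat.cast_nonneg n : (0 : ℝ) ≤ n)]

lemma lowerFactor_lt (n : ℕ) : 1 - 1 / ((n : ℝ) + 2) < 1 :=
  sub_lt_self _ (by positivity)

lemma lt_upperFactor (n : ℕ) : 1 < 1 + 1 / ((n : ℝ) + 2) :=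
  lt_add_of_pos_right _ (by positivity)

lemma factor_succ_le (n : ℕ) : 1 / (((n + 1 : ℕ) : ℝ) + 2) ≤ 1 / ((n : ℝ) + 2) := by
  push_cast
  gcongr
  linarith

lemma tendsto_factor : Tendsto (fun n : ℕ => 1 / ((n : ℝ) + 2)) atTop (𝓝 0) :=
  tendsto_const_nhds.div_atTop (tendsto_atTop_add_const_right _ _ tendsto_natCast_atTop_atTop)

lemma lam_mul_meanSojourn_pos (i : ι) (j : J) (r : ℝ) : 0 < N.lam i j * N.meanSojourn j r :=
  mul_pos (N.lam_pos i j) (N.meanSojourn_pos j r)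

lemma lam_mul_meanSojourn_anti (i : ι) (j : J) {r s : ℝ} (h : r ≤ s) :
    N.lam i j * N.meanSojourn j s ≤ N.lam i j * N.meanSojourn j r :=
  mul_le_mul_of_nonneg_left (N.meanSojourn_anti j h) (N.lam_pos i j).le

variable (p : (ι → J → ℝ) → ι → J → ℝ)

lemma lower_pos (n : ℕ) (i : ι) (j : J) : 0 < N.lower p n i j := by
  cases n <;> exact mul_pos (lowerFactor_pos _) (N.lam_mul_meanSojourn_pos i j _)

lemma upper_pos (n : ℕ) (i : ι) (j : J) : 0 < N.upper p n i j := by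
  cases n <;> exact mul_pos (one_pos.trans (lt_upperFactor _)) (N.lam_mul_meanSojourn_pos i j _)

variable {N p} {m : FlowModel}

/-- No rate exceeds `cmax`, so the first step goes up; the order-preserving map propagates this, and
the factors increase with `n`. -/
lemma lower_le_succ (hp : N.IsAllocation m p) (hmono : IsMonotone p) (n : ℕ) :
    ∀ i j, N.lower p n i j ≤ N.lower p (n + 1) i j := by
  have hθ : ∀ n : ℕ, 1 - 1 / ((n : ℝ) + 2) ≤ 1 - 1 / (((n + 1 : ℕ) : ℝ) + 2) := fun n =>
    sub_le_sub_left (factor_succ_le n) 1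
  induction n with
  | zero =>
    intro i j
    refine mul_le_mul (hθ 0) (N.lam_mul_meanSojourn_anti i j ?_)
      (N.lam_mul_meanSojourn_pos i j _).le (lowerFactor_pos _).le
    exact hp.le_cmax (fun i j => (N.lower_pos p 0 i j).le) i j
  | succ n ih =>
    intro i j
    exact mul_le_mul (hθ (n + 1)) (N.lam_mul_meanSojourn_anti i j
      (hmono _ _ (N.lower_pos p n) ih i j))
      (N.lam_mul_meanSojourn_pos i j _).le (lowerFactor_pos _).le

lemma upper_succ_le (hp : N.IsAllocation m p) (hmono : IsMonotone p) (n : ℕ) :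
    ∀ i j, N.upper p (n + 1) i j ≤ N.upper p n i j := by
  have hθ : ∀ n : ℕ, 1 + 1 / (((n + 1 : ℕ) : ℝ) + 2) ≤ 1 + 1 / ((n : ℝ) + 2) := fun n =>
    add_le_add_right (factor_succ_le n) 1
  have hθ0 : ∀ n : ℕ, 0 ≤ 1 + 1 / ((n : ℝ) + 2) := fun n => by positivity
  induction n with
  | zero =>
    intro i j
    refine mul_le_mul (hθ 0) (N.lam_mul_meanSojourn_anti i j ?_)
      (N.lam_mul_meanSojourn_pos i j _).le (hθ0 _)
    exact hp.nonneg (fun i j => (N.upper_pos p 0 i j).le) i j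
  | succ n ih =>
    intro i j
    exact mul_le_mul (hθ (n + 1)) (N.lam_mul_meanSojourn_anti i j
      (hmono _ _ (N.upper_pos p (n + 1)) ih i j))
      (N.lam_mul_meanSojourn_pos i j _).le (hθ0 _)

lemma lower_le_upper (hmono : IsMonotone p) (n : ℕ) :
    ∀ i j, N.lower p n i j ≤ N.upper p n i j := by
  have hθ : ∀ n : ℕ, 1 - 1 / ((n : ℝ) + 2) ≤ 1 + 1 / ((n : ℝ) + 2) := fun n =>
    (lowerFactor_lt n).le.trans (lt_upperFactor n).le
  have hθ0 : ∀ n : ℕ, 0 ≤ 1 + 1 / ((n : ℝ) + 2) := fun n => by positivity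
  induction n with
  | zero =>
    intro i j
    exact mul_le_mul (hθ 0) (N.lam_mul_meanSojourn_anti i j (N.cmax_pos j).le)
      (N.lam_mul_meanSojourn_pos i j _).le (hθ0 _)
  | succ n ih =>
    intro i j
    exact mul_le_mul (hθ (n + 1)) (N.lam_mul_meanSojourn_anti i j
      (hmono _ _ (N.lower_pos p n) ih i j))
      (N.lam_mul_meanSojourn_pos i j _).le (hθ0 _)

/-- The iterates from below and from above have a common limit, a fixed point. -/
theorem exists_common_limit (hp : N.IsAllocation m p) (hmono : IsMonotone p)
    (hinf : ∀ j, N.infRatio j ≤ 1 / N.cmax j) :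
    ∃ z : ι → J → ℝ, (∀ i j, z i j = N.lam i j * N.meanSojourn j (p z i j)) ∧
      (∀ i j, Tendsto (fun n => N.lower p n i j) atTop (𝓝 (z i j))) ∧
      (∀ i j, Tendsto (fun n => N.upper p n i j) atTop (𝓝 (z i j))) := by
  have hl0 : ∀ n i j, 0 ≤ N.lower p n i j := fun n i j => (N.lower_pos p n i j).le
  have hu0 : ∀ n i j, 0 ≤ N.upper p n i j := fun n i j => (N.upper_pos p n i j).le
  have hlmono : ∀ i j, Monotone fun n => N.lower p n i j := fun i j =>
    monotone_nat_of_le_succ fun n => lower_le_succ hp hmono n i j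
  have humono : ∀ i j, Antitone fun n => N.upper p n i j := fun i j =>
    antitone_nat_of_succ_le fun n => upper_succ_le hp hmono n i j
  have hlbdd : ∀ i j, BddAbove (range fun n => N.lower p n i j) := by
    rintro i j
    refine ⟨N.upper p 0 i j, ?_⟩
    rintro _ ⟨n, rfl⟩
    exact (lower_le_upper hmono n i j).trans (humono i j (Nat.zero_le n))
  have hubdd : ∀ i j, BddBelow (range fun n => N.upper p n i j) := by
    rintro i j
    refine ⟨0, ?_⟩
    rintro _ ⟨n, rfl⟩
    exact hu0 n i j
  have hpl : ∀ i j, Antitone fun n => p (N.lower p n) i j := fun i j n k hnk =>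
    hmono _ _ (N.lower_pos p n) (fun i j => hlmono i j hnk) i j
  have hpu : ∀ i j, Monotone fun n => p (N.upper p n) i j := fun i j n k hnk =>
    hmono _ _ (N.upper_pos p k) (fun i j => humono i j hnk) i j
  have hplbdd : ∀ i j, BddBelow (range fun n => p (N.lower p n) i j) := by
    rintro i j
    refine ⟨0, ?_⟩
    rintro _ ⟨n, rfl⟩
    exact hp.nonneg (hl0 n) i j
  have hpubdd : ∀ i j, BddAbove (range fun n => p (N.upper p n) i j) := by
    rintro i j
    refine ⟨N.cmax j, ?_⟩
    rintro _ ⟨n, rfl⟩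
    exact hp.le_cmax (hu0 n) i j
  have hx := fun i j => tendsto_atTop_ciSup (hlmono i j) (hlbdd i j)
  have hw := fun i j => tendsto_atTop_ciInf (humono i j) (hubdd i j)
  have ha := fun i j => tendsto_atTop_ciInf (hpl i j) (hplbdd i j)
  have hb := fun i j => tendsto_atTop_ciSup (hpu i j) (hpubdd i j)
  have hble := fun n i j => le_ciSup (hpubdd i j) n
  have hale := fun n i j => ciInf_le (hplbdd i j) n
  have hxle := fun n i j => le_ciSup (hlbdd i j) n
  have hwle := fun n i j => ciInf_le (hubdd i j) n
  -- Limits of the states (`x` from below, `w` from above) and of the corresponding rates (`a`,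
  -- `b`).
  generalize hxdef : (fun i j => ⨆ n, N.lower p n i j) = x at *
  generalize hwdef : (fun i j => ⨅ n, N.upper p n i j) = w at *
  generalize hadef : (fun i j => ⨅ n, p (N.lower p n) i j) = a at *
  generalize hbdef : (fun i j => ⨆ n, p (N.upper p n) i j) = b at *
  replace hxdef := fun i j => congrFun (congrFun hxdef i) j
  replace hwdef := fun i j => congrFun (congrFun hwdef i) j
  replace hadef := fun i j => congrFun (congrFun hadef i) j
  replace hbdef := fun i j => congrFun (congrFun hbdef i) j
  simp only [hxdef] at hx hxle
  simp only [hwdef] at hw hwle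
  simp only [hadef] at ha hale
  simp only [hbdef] at hb hble
  have hxfix : ∀ i j, x i j = N.lam i j * N.meanSojourn j (a i j) := by
    intro i j
    refine tendsto_nhds_unique ((tendsto_add_atTop_iff_nat 1).2 (hx i j)) ?_
    have h1 := (tendsto_add_atTop_iff_nat 1).2 (tendsto_factor.const_sub 1)
    have h2 := (((N.continuous_meanSojourn j).tendsto (a i j)).comp (ha i j)).const_mul
      (N.lam i j)
    have h3 := h1.mul h2
    rw [sub_zero, one_mul] at h3
    exact h3
  have hwfix : ∀ i j, w i j = N.lam i j * N.meanSojourn j (b i j) := by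
    intro i j
    refine tendsto_nhds_unique ((tendsto_add_atTop_iff_nat 1).2 (hw i j)) ?_
    have h1 := (tendsto_add_atTop_iff_nat 1).2 (tendsto_factor.const_add 1)
    have h2 := (((N.continuous_meanSojourn j).tendsto (b i j)).comp (hb i j)).const_mul
      (N.lam i j)
    have h3 := h1.mul h2
    rw [add_zero, one_mul] at h3
    exact h3
  have hba : ∀ i j, b i j ≤ a i j := fun i j =>
    le_of_tendsto_of_tendsto' (hb i j) (ha i j) fun n =>
      hmono _ _ (N.lower_pos p n) (lower_le_upper hmono n) i j
  have hb0 : ∀ i j, 0 ≤ b i j := fun i j => (hp.nonneg (hu0 0) i j).trans (hble 0 i j)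
  have hac : ∀ i j, a i j ≤ N.cmax j := fun i j => (hale 0 i j).trans (hp.le_cmax (hl0 0) i j)
  -- The required domination of loads is `λ b m(b) ≤ λ a m(a)`, the monotonicity of the mean energy.
  have hload := hp.limit_load_eq (N.lower_pos p) (lower_le_upper hmono) hx hw
    (fun i j => by rw [hwfix]; exact N.lam_mul_meanSojourn_pos i j _) ha hble
    (fun i j => by
      rw [hxfix, hwfix, mul_assoc, mul_assoc, mul_comm _ (b i j), mul_comm _ (a i j)]
      exact mul_le_mul_of_nonneg_left
        (N.mul_meanSojourn_mono (hb0 i j) (hba i j) (hac i j) (hinf j)) (N.lam_pos i j).le)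
  have hab : ∀ i j, a i j = b i j := by
    intro i j
    by_contra hne
    have hlt := N.mul_meanSojourn_lt (hb0 i j) (lt_of_le_of_ne (hba i j) (Ne.symm hne))
      (hac i j) (hinf j)
    have h := hload i j
    rw [hxfix, hwfix, mul_assoc, mul_assoc, mul_comm _ (b i j), mul_comm _ (a i j)] at h
    exact hlt.ne' (mul_left_cancel₀ (N.lam_pos i j).ne' h)
  have hxw : x = w := by
    funext i j
    rw [hxfix, hwfix, hab]
  have hx0 : ∀ i j, 0 < x i j := fun i j => (N.lower_pos p 0 i j).trans_le (hxle 0 i j)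
  -- Monotonicity replaces continuity of `p`: `lower n ≤ x` gives `p x ≤ a`, and `x = w ≤ upper n`
  -- gives `b ≤ p x`.
  have hpx : ∀ i j, p x i j = a i j := by
    intro i j
    refine le_antisymm ?_ ?_
    · exact ge_of_tendsto' (ha i j) fun n => hmono _ _ (N.lower_pos p n) (hxle n) i j
    · rw [hab]
      refine le_of_tendsto' (hb i j) fun n => hmono _ _ hx0 (fun i j => ?_) i j
      rw [hxw]
      exact hwle n i j
  exact ⟨x, fun i j => by rw [hpx]; exact hxfix i j, hx, hxw ▸ hw⟩

/-- Induction with the order-preserving map; the factors below and above `1` only loosen the bounds.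
Uniqueness of the fixed point follows by letting `n → ∞`. -/
lemma bounds_of_fixedPoint (hp : N.IsAllocation m p) (hmono : IsMonotone p) {y : ι → J → ℝ}
    (hy : ∀ i j, 0 < y i j) (hfix : ∀ i j, y i j = N.lam i j * N.meanSojourn j (p y i j))
    (n : ℕ) : (∀ i j, N.lower p n i j ≤ y i j) ∧ (∀ i j, y i j ≤ N.upper p n i j) := by
  have hy0 : ∀ i j, 0 ≤ y i j := fun i j => (hy i j).le
  have hlow : ∀ (k : ℕ) (r : ι → J → ℝ), (∀ i j, p y i j ≤ r i j) → ∀ i j,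
      (1 - 1 / ((k : ℝ) + 2)) * (N.lam i j * N.meanSojourn j (r i j)) ≤ y i j := by
    intro k r hr i j
    rw [hfix i j]
    exact (mul_le_of_le_one_left (N.lam_mul_meanSojourn_pos i j _).le (lowerFactor_lt k).le).trans
      (N.lam_mul_meanSojourn_anti i j (hr i j))
  have hup : ∀ (k : ℕ) (r : ι → J → ℝ), (∀ i j, r i j ≤ p y i j) → ∀ i j,
      y i j ≤ (1 + 1 / ((k : ℝ) + 2)) * (N.lam i j * N.meanSojourn j (r i j)) := by
    intro k r hr i j
    rw [hfix i j]
    exact (N.lam_mul_meanSojourn_anti i j (hr i j)).trans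
      (le_mul_of_one_le_left (N.lam_mul_meanSojourn_pos i j _).le (lt_upperFactor k).le)
  induction n with
  | zero => exact ⟨hlow 0 (fun _ j => N.cmax j) (hp.le_cmax hy0), hup 0 0 (hp.nonneg hy0)⟩
  | succ n ih =>
    exact ⟨hlow (n + 1) (p (N.lower p n)) (hmono _ _ (N.lower_pos p n) ih.1),
      hup (n + 1) (p (N.upper p n)) (hmono _ _ hy ih.2)⟩

/-- Positivity is automatic, because mean sojourn times are positive; it is what allows `IsMonotone`
to be applied at a fixed point. -/
lemma isFixedPoint_iff (hp : N.IsAllocation m p) (hK : ∀ i, N.K i = ⊤) {y : ι → J → ℝ} :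
    N.IsFixedPoint p y ↔
      (∀ i j, 0 < y i j) ∧ ∀ i j, y i j = N.lam i j * N.meanSojourn j (p y i j) := by
  have key : (∀ i j, 0 ≤ y i j) → ∀ i j, N.gammaInf i j *
      ∫⁻ x, min (ENNReal.ofReal x.2) (ENNReal.ofReal x.1 / ENNReal.ofReal (p y i j)) ∂(N.F j) =
      ENNReal.ofReal (N.lam i j * N.meanSojourn j (p y i j)) := by
    intro hy i j
    rw [N.gammaInf_of_top (hK i), ENNReal.ofReal_mul (N.lam_pos i j).le, meanSojourn,
      ofReal_integral_eq_lintegral_ofReal (N.integrable_sojourn j _)]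
    · congr 1
      refine lintegral_congr_ae ?_
      filter_upwards [N.F_pos j] with x hx
      exact ofReal_sojourn (hp.nonneg hy i j) hx
    · filter_upwards [N.F_pos j] with x hx
      exact (sojourn_pos hx).le
  constructor
  · intro h
    have hy : ∀ i j, 0 ≤ y i j := fun i j => (h i j).1
    have hfix : ∀ i j, y i j = N.lam i j * N.meanSojourn j (p y i j) := fun i j =>
      (ENNReal.ofReal_eq_ofReal_iff (hy i j) (N.lam_mul_meanSojourn_pos i j _).le).1
        ((h i j).2.trans (key hy i j))
    exact ⟨fun i j => by rw [hfix]; exact N.lam_mul_meanSojourn_pos i j _, hfix⟩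
  · rintro ⟨hy, hfix⟩ i j
    refine ⟨(hy i j).le, ?_⟩
    rw [key (fun i j => (hy i j).le), ← hfix]

end Network

/-! ### Asymptotic bounds for fluid solutions -/

lemma tendsto_measureReal_tail (μ : Measure (ℝ × ℝ)) [IsProbabilityMeasure μ] :
    Tendsto (fun t : ℝ => μ.real {x | t ≤ x.2}) atTop (𝓝 0) := by
  have h : Tendsto (fun t : ℝ => μ {x | t ≤ x.2}) atTop (𝓝 (μ (⋂ t : ℝ, {x | t ≤ x.2}))) :=
    tendsto_measure_iInter_atTop
      (fun t => (measurableSet_le measurable_const measurable_snd).nullMeasurableSet)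
      (fun s t hst x hx => le_trans hst hx) ⟨0, measure_ne_top _ _⟩
  have h0 : (⋂ t : ℝ, {x : ℝ × ℝ | t ≤ x.2}) = ∅ := by
    refine eq_empty_of_forall_notMem fun x hx => ?_
    have : x.2 + 1 ≤ x.2 := mem_iInter.1 hx (x.2 + 1)
    linarith
  rw [h0, measure_empty] at h
  exact (ENNReal.tendsto_toReal ENNReal.zero_ne_top).comp h

namespace Network

variable {ι J : Type*} [Fintype ι] [Fintype J] (N : Network ι J)

/-- The probability that a vehicle that arrived at time `s` is still in the system, uncharged, at
time `t`, when the charging rate is `P`. -/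
noncomputable def presence (j : J) (P : ℝ → ℝ) (t s : ℝ) : ℝ :=
  (N.F j).real {x | (∫ v in s..t, P v) < x.1 ∧ t - s ≤ x.2}

section presence

variable {j : J} {P : ℝ → ℝ}

lemma intervalIntegrable_of_nonneg
    (hPint : ∀ t, 0 ≤ t → IntervalIntegrable P volume 0 t)
    {s t : ℝ} (hs : 0 ≤ s) (ht : 0 ≤ t) :
    IntervalIntegrable P volume s t := (hPint s hs).symm.trans (hPint t ht)

/-- A later arrival is younger and has received less energy. Monotonicity in the arrival time also
yields integrability. -/
lemma presence_monotoneOn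
    (hPint : ∀ t, 0 ≤ t → IntervalIntegrable P volume 0 t)
    (hP : ∀ v, 0 ≤ v → 0 ≤ P v) {t : ℝ} :
    MonotoneOn (N.presence j P t) (Icc 0 t) := by
  intro s hs r hr hsr
  refine measureReal_mono fun x hx => ⟨lt_of_le_of_lt ?_ hx.1, le_trans (by linarith) hx.2⟩
  have h1 := intervalIntegral.integral_add_adjacent_intervals
    (intervalIntegrable_of_nonneg hPint hs.1 hr.1)
    (intervalIntegrable_of_nonneg hPint hr.1 (hr.1.trans hr.2))
  have h2 : 0 ≤ ∫ v in s..r, P v :=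
    intervalIntegral.integral_nonneg hsr fun v hv => hP v (hs.1.trans hv.1)
  linarith

lemma presence_integrable
    (hPint : ∀ t, 0 ≤ t → IntervalIntegrable P volume 0 t)
    (hP : ∀ v, 0 ≤ v → 0 ≤ P v) {a b t : ℝ} (ha : 0 ≤ a) (hab : a ≤ b)
    (hb : b ≤ t) : IntervalIntegrable (N.presence j P t) volume a b := by
  refine MonotoneOn.intervalIntegrable ((N.presence_monotoneOn hPint hP).mono ?_)
  rw [uIcc_of_le hab]
  exact Icc_subset_Icc ha hb

lemma survival_le_presence
    (hPint : ∀ t, 0 ≤ t → IntervalIntegrable P volume 0 t)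
    {c T s t : ℝ} (hT : 0 ≤ T) (hc : ∀ v, T ≤ v → P v ≤ c) (hs : T ≤ s)
    (hst : s ≤ t) : N.survival j c (t - s) ≤ N.presence j P t s := by
  refine measureReal_mono fun x hx => ⟨lt_of_le_of_lt ?_ hx.1, hx.2⟩
  calc ∫ v in s..t, P v ≤ ∫ _v in s..t, c :=
        intervalIntegral.integral_mono_on hst
          (intervalIntegrable_of_nonneg hPint (hT.trans hs) (hT.trans (hs.trans hst)))
          intervalIntegrable_const fun v hv => hc v (hs.trans hv.1)
    _ = c * (t - s) := by rw [intervalIntegral.integral_const, smul_eq_mul, mul_comm]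

lemma presence_le_survival
    (hPint : ∀ t, 0 ≤ t → IntervalIntegrable P volume 0 t)
    {c T s t : ℝ} (hT : 0 ≤ T) (hc : ∀ v, T ≤ v → c ≤ P v) (hs : T ≤ s)
    (hst : s ≤ t) : N.presence j P t s ≤ N.survival j c (t - s) := by
  refine measureReal_mono fun x hx => ⟨lt_of_le_of_lt ?_ hx.1, hx.2⟩
  calc c * (t - s) = ∫ _v in s..t, c := by
        rw [intervalIntegral.integral_const, smul_eq_mul, mul_comm]
    _ ≤ ∫ v in s..t, P v :=
        intervalIntegral.integral_mono_on hst intervalIntegrable_const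
          (intervalIntegrable_of_nonneg hPint (hT.trans hs) (hT.trans (hs.trans hst)))
          fun v hv => hc v (hs.trans hv.1)

lemma intervalIntegrable_survival {c : ℝ} (hc : 0 ≤ c) (a b : ℝ) :
    IntervalIntegrable (N.survival j c) volume a b :=
  (N.survival_antitone j hc).intervalIntegrable

lemma intervalIntegrable_survival_sub {c : ℝ} (hc : 0 ≤ c) (t a b : ℝ) :
    IntervalIntegrable (fun s => N.survival j c (t - s)) volume a b := by
  refine Monotone.intervalIntegrable fun s r hsr => ?_
  exact N.survival_antitone j hc (by linarith)

/-- Arrivals before `T` are discarded; the later ones are charged no faster than at rate `c`. -/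
lemma integral_survival_le
    (hPint : ∀ t, 0 ≤ t → IntervalIntegrable P volume 0 t)
    {c T t : ℝ} (hP : ∀ v, 0 ≤ v → 0 ≤ P v) (hc0 : 0 ≤ c) (hT : 0 ≤ T)
    (hTt : T ≤ t) (hc : ∀ v, T ≤ v → P v ≤ c) :
    ∫ v in (0 : ℝ)..(t - T), N.survival j c v ≤ ∫ s in (0 : ℝ)..t, N.presence j P t s := by
  rw [← intervalIntegral.integral_add_adjacent_intervals
    (N.presence_integrable hPint hP le_rfl hT hTt) (N.presence_integrable hPint hP hT hTt le_rfl)]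
  have h1 : 0 ≤ ∫ s in (0 : ℝ)..T, N.presence j P t s :=
    intervalIntegral.integral_nonneg hT fun v _ => measureReal_nonneg
  have h2 : ∫ s in T..t, N.survival j c (t - s) ≤ ∫ s in T..t, N.presence j P t s :=
    intervalIntegral.integral_mono_on hTt (N.intervalIntegrable_survival_sub hc0 t T t)
      (N.presence_integrable hPint hP hT hTt le_rfl)
      fun s hs => N.survival_le_presence hPint hT hc hs.1 hs.2
  rw [intervalIntegral.integral_comp_sub_left (N.survival j c), sub_self] at h2
  linarith

/-- Arrivals before `T` are treated as never charged (rate `0`). They contribute the difference of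
two integrals with the same limit, which vanishes as `t → ∞`. -/
lemma integral_presence_le
    (hPint : ∀ t, 0 ≤ t → IntervalIntegrable P volume 0 t)
    {c T t : ℝ} (hP : ∀ v, 0 ≤ v → 0 ≤ P v) (hc0 : 0 ≤ c) (hT : 0 ≤ T)
    (hTt : T ≤ t) (hc : ∀ v, T ≤ v → c ≤ P v) :
    ∫ s in (0 : ℝ)..t, N.presence j P t s ≤
      ((∫ v in (0 : ℝ)..t, N.survival j 0 v) - ∫ v in (0 : ℝ)..(t - T), N.survival j 0 v) +
        ∫ v in (0 : ℝ)..(t - T), N.survival j c v := by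
  rw [← intervalIntegral.integral_add_adjacent_intervals
    (N.presence_integrable hPint hP le_rfl hT hTt) (N.presence_integrable hPint hP hT hTt le_rfl),
    intervalIntegral.integral_interval_sub_left (N.intervalIntegrable_survival le_rfl _ _)
      (N.intervalIntegrable_survival le_rfl _ _)]
  have h1 : ∫ s in (0 : ℝ)..T, N.presence j P t s ≤ ∫ s in (0 : ℝ)..T, N.survival j 0 (t - s) :=
    intervalIntegral.integral_mono_on hT (N.presence_integrable hPint hP le_rfl hT hTt)
      (N.intervalIntegrable_survival_sub le_rfl t 0 T)
      fun s hs => N.presence_le_survival hPint le_rfl hP hs.1 (hs.2.trans hTt)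
  have h2 : ∫ s in T..t, N.presence j P t s ≤ ∫ s in T..t, N.survival j c (t - s) :=
    intervalIntegral.integral_mono_on hTt (N.presence_integrable hPint hP hT hTt le_rfl)
      (N.intervalIntegrable_survival_sub hc0 t T t)
      fun s hs => N.presence_le_survival hPint hT hc hs.1 hs.2
  rw [intervalIntegral.integral_comp_sub_left (N.survival j 0), sub_zero] at h1
  rw [intervalIntegral.integral_comp_sub_left (N.survival j c), sub_self] at h2
  exact add_le_add h1 h2

end presence

variable {N} {m : FlowModel} {p : (ι → J → ℝ) → ι → J → ℝ} {F₀ : ι → J → Measure (ℝ × ℝ)}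
  {z : ℝ → ι → J → ℝ}

lemma IsFluidSolution.eq_presence (hK : ∀ i, N.K i = ⊤) (h : N.IsFluidSolution p F₀ z) {t : ℝ}
    (ht : 0 ≤ t) (i : ι) (j : J) :
    z t i j =
      z 0 i j * (F₀ i j).real {x | (∫ v in (0 : ℝ)..t, p (z v) i j) < x.1 ∧ t ≤ x.2} +
        N.lam i j * ∫ s in (0 : ℝ)..t, N.presence j (fun v => p (z v) i j) t s := by
  obtain ⟨-, -, -, -, q, -, -, -, hz⟩ := h
  rw [hz t ht i j, ← intervalIntegral.integral_const_mul]
  simp only [N.gammaT_of_top (hK i)]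
  rfl

lemma IsFluidSolution.rate_nonneg (hp : N.IsAllocation m p) (h : N.IsFluidSolution p F₀ z)
    (i : ι) (j : J) {v : ℝ} (hv : 0 ≤ v) : 0 ≤ p (z v) i j :=
  hp.nonneg (h.2.1 v hv) i j

lemma tendsto_integral_survival_sub (j : J) {c : ℝ} (hc : 0 ≤ c) (T : ℝ) :
    Tendsto (fun t => ∫ v in (0 : ℝ)..(t - T), N.survival j c v) atTop
      (𝓝 (N.meanSojourn j c)) :=
  (N.tendsto_integral_survival j hc).comp (tendsto_atTop_add_const_right _ (-T) tendsto_id)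

/-- The initial population is dropped, and `θ < 1` turns the limiting lower bound `λ m(c)` into an
inequality valid from some time on. -/
lemma IsFluidSolution.eventually_ge (hp : N.IsAllocation m p) (hK : ∀ i, N.K i = ⊤)
    (h : N.IsFluidSolution p F₀ z) {i : ι} {j : J} {c θ : ℝ} (hc0 : 0 ≤ c) (hθ : θ < 1)
    (hc : ∀ᶠ v in atTop, p (z v) i j ≤ c) :
    ∀ᶠ t in atTop, θ * (N.lam i j * N.meanSojourn j c) ≤ z t i j := by
  obtain ⟨T, hT⟩ := eventually_atTop.1 (hc.and (eventually_ge_atTop 0))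
  have hT0 : 0 ≤ T := (hT T le_rfl).2
  have hlim := (tendsto_integral_survival_sub (N := N) j hc0 T).const_mul (N.lam i j)
  have hlt : θ * (N.lam i j * N.meanSojourn j c) < N.lam i j * N.meanSojourn j c :=
    mul_lt_of_lt_one_left (mul_pos (N.lam_pos i j) (N.meanSojourn_pos j c)) hθ
  filter_upwards [hlim.eventually_const_lt hlt, eventually_ge_atTop T] with t ht hTt
  rw [h.eq_presence hK (hT0.trans hTt)]
  have h1 := N.integral_survival_le (j := j) (fun t ht => h.2.2.2.1 t ht i j)
    (fun v hv => h.rate_nonneg hp i j hv) hc0 hT0 hTt (fun v hv => (hT v hv).1)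
  have h2 := mul_le_mul_of_nonneg_left h1 (N.lam_pos i j).le
  have h3 := mul_nonneg (h.2.1 0 le_rfl i j) (measureReal_nonneg (μ := F₀ i j)
    (s := {x | (∫ v in (0 : ℝ)..t, p (z v) i j) < x.1 ∧ t ≤ x.2}))
  linarith

lemma IsFluidSolution.eventually_le (hp : N.IsAllocation m p) (hK : ∀ i, N.K i = ⊤)
    (h : N.IsFluidSolution p F₀ z) {i : ι} {j : J} {c θ : ℝ} (hc0 : 0 ≤ c) (hθ : 1 < θ)
    (hc : ∀ᶠ v in atTop, c ≤ p (z v) i j) :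
    ∀ᶠ t in atTop, z t i j ≤ θ * (N.lam i j * N.meanSojourn j c) := by
  obtain ⟨T, hT⟩ := eventually_atTop.1 (hc.and (eventually_ge_atTop 0))
  have hT0 : 0 ≤ T := (hT T le_rfl).2
  have := (h.1 i j).1
  have hlim := ((tendsto_measureReal_tail (F₀ i j)).const_mul (z 0 i j)).add
    ((((N.tendsto_integral_survival j le_rfl).sub
      (tendsto_integral_survival_sub (N := N) j le_rfl T)).add
      (tendsto_integral_survival_sub (N := N) j hc0 T)).const_mul (N.lam i j))
  rw [mul_zero, zero_add, sub_self, zero_add] at hlim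
  have hlt : N.lam i j * N.meanSojourn j c < θ * (N.lam i j * N.meanSojourn j c) :=
    lt_mul_of_one_lt_left (mul_pos (N.lam_pos i j) (N.meanSojourn_pos j c)) hθ
  filter_upwards [hlim.eventually_lt_const hlt, eventually_ge_atTop T] with t ht hTt
  rw [h.eq_presence hK (hT0.trans hTt)]
  refine le_trans (add_le_add ?_ ?_) ht.le
  · exact mul_le_mul_of_nonneg_left (measureReal_mono fun x hx => hx.2) (h.2.1 0 le_rfl i j)
  · exact mul_le_mul_of_nonneg_left (N.integral_presence_le (fun t ht => h.2.2.2.1 t ht i j)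
      (fun v hv => h.rate_nonneg hp i j hv) hc0 hT0 hTt (fun v hv => (hT v hv).1))
      (N.lam_pos i j).le

/-- A fluid-model solution is eventually between the iterates from below and from above. -/
lemma IsFluidSolution.eventually_mem (hp : N.IsAllocation m p) (hmono : IsMonotone p)
    (hK : ∀ i, N.K i = ⊤) (h : N.IsFluidSolution p F₀ z) (n : ℕ) :
    (∀ᶠ t in atTop, ∀ i j, N.lower p n i j ≤ z t i j) ∧
      (∀ᶠ t in atTop, ∀ i j, z t i j ≤ N.upper p n i j) := by
  -- Kept outside the induction: the upper bounds apply `IsMonotone` with `z t` as the smaller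
  -- state, which must be positive.
  have hlow0 : ∀ᶠ t in atTop, ∀ i j, N.lower p 0 i j ≤ z t i j := by
    simp only [eventually_all]
    intro i j
    refine h.eventually_ge hp hK (N.cmax_pos j).le (lowerFactor_lt 0) ?_
    filter_upwards [eventually_ge_atTop 0] with v hv
    exact hp.le_cmax (h.2.1 v hv) i j
  induction n with
  | zero =>
    refine ⟨hlow0, ?_⟩
    simp only [eventually_all]
    intro i j
    refine h.eventually_le hp hK le_rfl (lt_upperFactor 0) ?_
    filter_upwards [eventually_ge_atTop 0] with v hv
    exact hp.nonneg (h.2.1 v hv) i j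
  | succ n ih =>
    constructor
    · simp only [eventually_all]
      intro i j
      refine h.eventually_ge hp hK (hp.nonneg (fun i j => (N.lower_pos p n i j).le) i j)
        (lowerFactor_lt (n + 1)) ?_
      filter_upwards [ih.1] with v hv
      exact hmono _ _ (N.lower_pos p n) hv i j
    · simp only [eventually_all]
      intro i j
      refine h.eventually_le hp hK (hp.nonneg (fun i j => (N.upper_pos p n i j).le) i j)
        (lt_upperFactor (n + 1)) ?_
      filter_upwards [ih.2, hlow0] with v hv hv0
      exact hmono _ _ (fun i j => (N.lower_pos p 0 i j).trans_le (hv0 i j)) hv i j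

/-! ### The fixed point as an invariant point -/

/-- A fixed point is an invariant point: give the initial vehicles the stationary law of the
residual times. -/
lemma isInvariantPoint_of_fixedPoint (hp : N.IsAllocation m p) (hK : ∀ i, N.K i = ⊤)
    {y : ι → J → ℝ} (hy : ∀ i j, 0 < y i j)
    (hfix : ∀ i j, y i j = N.lam i j * N.meanSojourn j (p y i j)) : N.IsInvariantPoint p y := by
  have hp0 : ∀ i j, 0 ≤ p y i j := hp.nonneg fun i j => (hy i j).le
  -- The stationary residual law: its density is the survival function over its integral, the mean
  -- sojourn time.
  let G : ι → J → Measure ℝ := fun i j => (volume.restrict (Ioi 0)).withDensity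
    fun v => ENNReal.ofReal (N.survival j (p y i j) v / N.meanSojourn j (p y i j))
  have hpos : ∀ i j, 0 < N.meanSojourn j (p y i j) := fun i j => N.meanSojourn_pos j _
  have hGdens : ∀ i j, IntegrableOn
      (fun v => N.survival j (p y i j) v / N.meanSojourn j (p y i j)) (Ioi 0) := fun i j =>
    (N.integrableOn_survival j (hp0 i j)).div_const _
  have hGset : ∀ i j (t : ℝ), 0 ≤ t → (G i j).real (Ici t) =
      1 - (∫ v in (0 : ℝ)..t, N.survival j (p y i j) v) / N.meanSojourn j (p y i j) := by
    intro i j t ht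
    have hr : (volume.restrict (Ioi (0 : ℝ))).restrict (Ici t) = volume.restrict (Ioi t) := by
      rw [Measure.restrict_restrict measurableSet_Ici]
      refine Measure.restrict_congr_set ?_
      rcases ht.eq_or_lt with rfl | ht
      · rw [inter_eq_right.2 Ioi_subset_Ici_self]
        exact EventuallyEq.rfl
      · rw [inter_eq_left.2 (Ici_subset_Ioi.2 ht)]
        exact Ioi_ae_eq_Ici.symm
    have hsplit := intervalIntegral.integral_interval_add_Ioi
      (N.integrableOn_survival j (hp0 i j))
      ((N.integrableOn_survival j (hp0 i j)).mono_set (Ioi_subset_Ioi ht))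
    rw [N.integral_survival j (hp0 i j)] at hsplit
    rw [measureReal_def, withDensity_apply _ measurableSet_Ici, hr,
      ← ofReal_integral_eq_lintegral_ofReal ((hGdens i j).mono_set (Ioi_subset_Ioi ht))
        (Eventually.of_forall fun v => div_nonneg (N.survival_nonneg j _ v) (hpos i j).le),
      ENNReal.toReal_ofReal (integral_nonneg fun v =>
        div_nonneg (N.survival_nonneg j _ v) (hpos i j).le), integral_div]
    rw [eq_sub_iff_add_eq, ← add_div, add_comm, hsplit, div_self (hpos i j).ne']
  have hGneg : ∀ i j, (G i j) (Iio 0) = 0 := by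
    intro i j
    rw [withDensity_apply _ measurableSet_Iio, Measure.restrict_restrict measurableSet_Iio]
    have : Iio (0 : ℝ) ∩ Ioi 0 = ∅ := by
      ext v
      simp only [mem_inter_iff, mem_Iio, mem_Ioi, mem_empty_iff_false, iff_false]
      exact fun h => lt_asymm h.1 h.2
    rw [this, Measure.restrict_empty, lintegral_zero_measure]
  have hGprob : ∀ i j, IsProbabilityMeasure (G i j) := by
    intro i j
    constructor
    have h1 : (G i j) univ = (G i j) (Ici 0) := by
      refine le_antisymm ?_ (measure_mono (subset_univ _))
      rw [← Iio_union_Ici (a := (0 : ℝ))]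
      refine (measure_union_le _ _).trans ?_
      rw [hGneg, zero_add]
    have h2 := hGset i j 0 le_rfl
    rw [intervalIntegral.integral_same, zero_div, sub_zero, measureReal_def] at h2
    rw [h1, ← ENNReal.toReal_eq_one_iff, h2]
  -- The surplus `+ 1` keeps the initial vehicles uncharged until their parking time `v` ends, so
  -- `v` alone decides when they leave.
  let φ : ι → J → ℝ → ℝ × ℝ := fun i j v => (p y i j * v + 1, v)
  have hφ : ∀ i j, Measurable (φ i j) := fun i j => by fun_prop
  have htail : ∀ i j t, ((G i j).map (φ i j)).real {x | t ≤ x.2} = (G i j).real (Ici t) := by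
    intro i j t
    rw [map_measureReal_apply (hφ i j) (measurableSet_le measurable_const measurable_snd)]
    rfl
  have hjoint : ∀ i j t, ((G i j).map (φ i j)).real {x | (∫ _v in (0 : ℝ)..t, p y i j) < x.1 ∧
      t ≤ x.2} = (G i j).real (Ici t) := by
    intro i j t
    have hmeas : MeasurableSet {x : ℝ × ℝ | (∫ _v in (0 : ℝ)..t, p y i j) < x.1 ∧ t ≤ x.2} :=
      (measurableSet_lt measurable_const measurable_fst).inter
        (measurableSet_le measurable_const measurable_snd)
    rw [map_measureReal_apply (hφ i j) hmeas]
    congr 1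
    ext v
    simp only [φ, intervalIntegral.integral_const, sub_zero, smul_eq_mul, mem_preimage,
      mem_ofPred_eq, mem_Ici, and_iff_right_iff_imp]
    intro hv
    nlinarith [mul_le_mul_of_nonneg_left hv (hp0 i j)]
  let q : ℝ → ι → J → ℝ := fun t i j => y i j * (G i j).real (Ici t) +
    ∫ s in (0 : ℝ)..t, N.lam i j * (N.F j).real {x | t - s ≤ x.2}
  have hq0 : ∀ i j, q 0 i j = y i j := by
    intro i j
    simp only [q]
    rw [hGset i j 0 le_rfl]
    simp
  refine ⟨fun i j => (G i j).map (φ i j), fun i j => ⟨?_, ?_⟩, fun t _ i j => (hy i j).le,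
    continuousOn_const, fun t _ i j => intervalIntegrable_const, q, fun i j => (hq0 i j).ge,
    fun t _ i j => ?_, fun t _ i j => ?_, fun t ht i j => ?_⟩
  · have := hGprob i j
    exact Measure.isProbabilityMeasure_map (hφ i j).aemeasurable
  · have hmeas : MeasurableSet {x : ℝ × ℝ | 0 ≤ x.1 ∧ 0 ≤ x.2} :=
      (measurableSet_le measurable_const measurable_fst).inter
        (measurableSet_le measurable_const measurable_snd)
    refine (ae_map_iff (hφ i j).aemeasurable hmeas).2 ?_
    have h0 : ∀ᵐ v ∂(G i j), v ∉ Iio (0 : ℝ) := measure_eq_zero_iff_ae_notMem.1 (hGneg i j)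
    filter_upwards [h0] with v hv
    have hv' : 0 ≤ v := not_lt.1 hv
    exact ⟨add_nonneg (mul_nonneg (hp0 i j) hv') zero_le_one, hv'⟩
  · rw [show N.gammaT q i j = fun _ => N.lam i j from funext fun t => N.gammaT_of_top (hK i) j t]
    exact intervalIntegrable_const
  · rw [hq0, htail]
    simp only [N.gammaT_of_top (hK i)]
    rfl
  · rw [hjoint, hGset i j t ht]
    simp only [N.gammaT_of_top (hK i), intervalIntegral.integral_const, smul_eq_mul]
    rw [intervalIntegral.integral_const_mul]
    have h1 : ∫ s in (0 : ℝ)..t, (N.F j).real {x | (t - s) * p y i j < x.1 ∧ t - s ≤ x.2} =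
        ∫ v in (0 : ℝ)..t, N.survival j (p y i j) v := by
      have h2 := intervalIntegral.integral_comp_sub_left (a := 0) (b := t)
        (N.survival j (p y i j)) t
      rw [sub_self, sub_zero] at h2
      rw [← h2]
      simp only [survival, mul_comm]
    rw [h1]
    -- With `I` the integral of the survival function up to `t`, the claim is `y = y (1 - I / m) + λ
    -- I`, which holds because `y = λ m`.
    have h3 := hfix i j
    have h4 := (hpos i j).ne'
    generalize p y i j = r at *
    rw [h3]
    field_simp
    ring

end Network

end EVCharging

theorem proposition2 {ι J : Type*} [Fintype ι] [Fintype J] (N : EVCharging.Network ι J)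
    (m : EVCharging.FlowModel) (p : (ι → J → ℝ) → ι → J → ℝ)
    (hp : N.IsAllocation m p) (hmono : EVCharging.IsMonotone p)
    (hK : ∀ i, N.K i = ⊤) (hinf : ∀ j, N.infRatio j ≤ 1 / N.cmax j) :
    ∃ zstar : ι → J → ℝ,
      (∀ y : ι → J → ℝ, N.IsInvariantPoint p y ↔ y = zstar) ∧
      (∀ y : ι → J → ℝ, N.IsFixedPoint p y ↔ y = zstar) ∧
      ∀ (F₀ : ι → J → MeasureTheory.Measure (ℝ × ℝ)) (z : ℝ → ι → J → ℝ),
        N.IsFluidSolution p F₀ z →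
          ∀ i j, Filter.Tendsto (fun t => z t i j) Filter.atTop (nhds (zstar i j)) := by
  obtain ⟨zstar, hfix, hlow, hup⟩ := EVCharging.Network.exists_common_limit hp hmono hinf
  have hpos : ∀ i j, 0 < zstar i j := fun i j => by
    rw [hfix]
    exact N.lam_mul_meanSojourn_pos i j _
  have hconv : ∀ (F₀ : ι → J → Measure (ℝ × ℝ)) (z : ℝ → ι → J → ℝ), N.IsFluidSolution p F₀ z →
      ∀ i j, Tendsto (fun t => z t i j) atTop (𝓝 (zstar i j)) := by
    intro F₀ z hz i j
    rw [tendsto_order]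
    constructor
    · intro a ha
      obtain ⟨n, hn⟩ := ((hlow i j).eventually_const_lt ha).exists
      filter_upwards [(hz.eventually_mem hp hmono hK n).1] with t ht
      exact hn.trans_le (ht i j)
    · intro a ha
      obtain ⟨n, hn⟩ := ((hup i j).eventually_lt_const ha).exists
      filter_upwards [(hz.eventually_mem hp hmono hK n).2] with t ht
      exact (ht i j).trans_lt hn
  refine ⟨zstar, fun y => ⟨?_, ?_⟩, fun y => ⟨?_, ?_⟩, hconv⟩
  · rintro ⟨F₀, hy⟩
    funext i j
    exact tendsto_nhds_unique tendsto_const_nhds (hconv F₀ _ hy i j)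
  · rintro rfl
    exact EVCharging.Network.isInvariantPoint_of_fixedPoint hp hK hpos hfix
  · intro hy
    obtain ⟨hy0, hyfix⟩ := (EVCharging.Network.isFixedPoint_iff hp hK).1 hy
    have hb := EVCharging.Network.bounds_of_fixedPoint hp hmono hy0 hyfix
    funext i j
    exact le_antisymm (ge_of_tendsto' (hup i j) fun n => (hb n).2 i j)
      (le_of_tendsto' (hlow i j) fun n => (hb n).1 i j)
  · rintro rfl
    exact (EVCharging.Network.isFixedPoint_iff hp hK).2 ⟨hpos, hfix⟩
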